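/- **Conventions.** Let $G$ be a topological group. A *$G$-flow* is a non-empty compact Hausdorff space $X$ with a continuous action $G\times X\to X$; it is *minimal* if every orbit is dense, and *$G$-topologically transitive* if $GB$ is dense for every non-empty open $B\subseteq X$. A *subflow* of a space on which $G$ acts is a non-empty compact $G$-invariant subset, and it is a minimal subflow if it properly contains no subflow. $\mathrm{SN}(G)$ is the set of bounded continuous functions $\sigma\colon G\to[0,\infty)$ with $\sigma(e)=0$, $\sigma(g)=\sigma(g^{-1})$, $\sigma(gh)\le\sigma(g)+\sigma(h)$, and $\mathrm{B}_\sigma(c)=\{g:\sigma(g)<c\}$. A *base of semi-norms* is a set $\mathcal B\subseteq \mathrm{SN}(G)$ such that the sets $\mathrm B_\sigma(\epsilon)$ ($\sigma\in\mathcal B$, $\epsilon>0$) form a neighbourhood base at $e$. A $G$-flow $X$ is *$G$-ED* if $\overline A\subseteq \mathrm{Int}\,\overline{\mathrm B_\sigma(c)A}$ for all open $A\subseteq X$, $\sigma\in \mathrm{SN}(G)$ and $c>0$. For $\sigma\in\mathrm{SN}(G)$, the function $\partial_\sigma\colon X\times X\to[0,\infty]$ is determined by: for $c\in[0,\infty)$,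 $\partial_\sigma(x,y)\le c$ iff $y\in\overline{\mathrm B_\sigma(c+\epsilon)A}$ for every $\epsilon>0$ and every open $A\ni x$. If $X$ is $G$-ED, $\partial_\sigma$ is a pseudometric; $\overline\partial_\sigma$ denotes the metric that it induces on the quotient space $X/\partial_\sigma$ (the quotient, with the quotient topology, by the relation $\partial_\sigma(x,y)=0$). Given $d\colon Y\times Y\to[0,\infty]$ on a space $Y$, a point $y$ is *$d$-compatible* if $y\in\mathrm{Int}\{z:d(y,z)<c\}$ for every $c>0$. For an identity neighbourhood $U$, a non-empty open $A\subseteq X$ is *$U$-TT* if $A\subseteq\overline{UB}$ for every non-empty open $B\subseteq A$; a set is *somewhere $U$-TT* if it contains a non-empty open $U$-TT set. $X$ satisfies the *Rosendal criterion* if for every identity neighbourhood $U$, every non-empty open subset of $X$ is somewhere $U$-TT. $X$ satisfies the *thickness condition* if for every identity neighbourhood $U$ there is a finite $F\subseteq G$ such that $UFA\cap UFB\ne\emptyset$ for all non-empty open $A,B\subseteq X$. For a $G$-space $Z$, $\mathrm S_G(Z)$ is the set of *near ultrafilters* on $Z$: the families of non-empty open subsets of $Z$ that are maximal with respect to the property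 that $UA_1\cap\dots\cap UA_n\neq\emptyset$ for all members $A_1,\dots,A_n$ and all identity neighbourhoods $U$. It carries the topology with base $\{p: A\notin p\}$ ($A\subseteq Z$ open), and $G$ acts by $gp=\{gA:A\in p\}$. For a set $I$ let $G$ act on $I\times X$ ($I$ discrete) by $g(i,x)=(i,gx)$. For an ultrafilter $\mathcal U$ on $I$, the *ultracopower* of $X$ along $\mathcal U$ is $\Sigma^G_{\mathcal U}X=\{p\in \mathrm S_G(I\times X): S\times X\in p\text{ for all }S\in\mathcal U\}$, and the *ultracopower map* $\Sigma^G_{\mathcal U}X\to X$ sends $p$ to the unique $x$ such that $I\times A\in p$ for every open $A\ni x$ (it is the restriction of the continuous extension of the projection $I\times X\to X$). A map $\pi\colon Y\to X$ is *highly proximal* if it is a continuous $G$-equivariant surjection and for every $x\in X$ there is a net $(g_i)$ in $G$ such that $g_i\pi^{-1}[x]$ converges in the Vietoris topology to a singleton. **Theorem.** Let $G$ be a topological group and $X$ a minimal $G$-ED flow. The following are equivalent. 1. $X$ satisfies the Rosendal criterion. 2. For each identity neighbourhood $U$, $X$ is somewhere $U$-TT. 3. $X$ satisfies the thickness condition.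 4. Every ultracopower of $X$ contains a unique minimal subflow. 5. For every ultracopower of $X$, the ultracopower map is highly proximal. 6. For each $\sigma\in\mathrm{SN}(G)$, the set of $\partial_\sigma$-compatible points is dense in $X$. 7. For each $\sigma\in\mathrm{SN}(G)$, the set of $\overline\partial_\sigma$-compatible points is dense in $X/\partial_\sigma$. 8. There is a base of semi-norms $\mathcal B\subseteq\mathrm{SN}(G)$ such that for each $\sigma\in\mathcal B$ there is some $\partial_\sigma$-compatible point. Moreover, the equivalences $1\Leftrightarrow 6\Leftrightarrow 7$ hold for every $G$-ED flow $X$ that is $G$-topologically transitive. -/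

import Mathlib

open Set Filter Topology
open scoped Pointwise ENNReal NNReal

noncomputable section

namespace GFlow

universe u v w

/-! ### Semi-norms on a topological group and the fattening they induce -/

section SemiNorms

variable (G : Type u) [Group G] [TopologicalSpace G]

/-- `SN(G)`: the bounded continuous semi-norms on `G`. -/
def SN : Set (GroupSeminorm G) :=
  {σ | Continuous σ ∧ ∃ C : ℝ, ∀ g, σ g ≤ C}

variable {G}

/-- The ball `B_σ(c) = {g : σ(g) < c}`. -/
def snBall (σ : GroupSeminorm G) (c : ℝ) : Set G := {g | σ g < c}

/-- A base of semi-norms: a set `B ⊆ SN(G)` such that the balls `B_σ(ε)`, for `σ ∈ B` and `ε > 0`,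
form a neighbourhood base at the identity. -/
def IsSNBase (B : Set (GroupSeminorm G)) : Prop :=
  B ⊆ SN G ∧
    (𝓝 (1 : G)).HasBasis (fun q : GroupSeminorm G × ℝ => q.1 ∈ B ∧ 0 < q.2)
      (fun q => snBall q.1 q.2)

end SemiNorms

section Spaces

variable (G : Type u) [Group G] [TopologicalSpace G] (X : Type v) [TopologicalSpace X]
  [MulAction G X]

/-- `X` is `G`-extremally disconnected: `cl A ⊆ Int cl (B_σ(c) A)` for all open `A`, all
`σ ∈ SN(G)` and all `c > 0`. -/
def IsGED : Prop :=
  ∀ σ ∈ SN G, ∀ c : ℝ, 0 < c → ∀ A : Set X, IsOpen A →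
    closure A ⊆ interior (closure (snBall σ c • A))

variable {G X}

/-- `A` is a non-empty open set which is `U`-topologically transitive: `A ⊆ cl (U B)` for every
non-empty open `B ⊆ A`. -/
def IsUTT (U : Set G) (A : Set X) : Prop :=
  IsOpen A ∧ A.Nonempty ∧ ∀ B : Set X, B ⊆ A → IsOpen B → B.Nonempty → A ⊆ closure (U • B)

/-- `A` is somewhere `U`-TT: it contains a non-empty open set which is `U`-TT. -/
def SomewhereUTT (U : Set G) (A : Set X) : Prop := ∃ A₀ ⊆ A, IsUTT U A₀

variable (G X)

/-- The Rosendal criterion. -/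
def RosendalCriterion : Prop :=
  ∀ U ∈ 𝓝 (1 : G), ∀ A : Set X, IsOpen A → A.Nonempty → SomewhereUTT U A

/-- The thickness condition: for each identity neighbourhood `U` there is a finite `F ⊆ G` such that
`U F A` meets `U F B` for all non-empty open `A` and `B`. -/
def ThicknessCondition : Prop :=
  ∀ U ∈ 𝓝 (1 : G), ∃ F : Finset G, ∀ A B : Set X, IsOpen A → A.Nonempty → IsOpen B → B.Nonempty →
    ((U • ((F : Set G) • A)) ∩ (U • ((F : Set G) • B))).Nonempty

end Spaces

/-! ### Compatibility points, the pseudometrics `∂_σ` and their metric quotients -/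

/-- `y` is a `d`-compatible point: it is interior to every ball `{z : d(y, z) < c}`, `c > 0`. -/
def IsCompatiblePoint {Y : Type v} [TopologicalSpace Y] (d : Y → Y → ℝ≥0∞) (y : Y) : Prop :=
  ∀ c : ℝ≥0∞, 0 < c → y ∈ interior {z | d y z < c}

section Pseudometric

variable {G : Type u} [Group G] {X : Type v} [TopologicalSpace X] [MulAction G X]

/-- The relation that defines `∂_σ(x, y) ≤ c`: for all `ε > 0` and all open `A ∋ x`, the point `y`
lies in `cl (B_σ(c + ε) A)`. -/
def PdistLE (σ : GroupSeminorm G) (c : ℝ≥0) (x y : X) : Prop :=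
  ∀ ε : ℝ, 0 < ε → ∀ A : Set X, IsOpen A → x ∈ A → y ∈ closure (snBall σ (c + ε) • A)

/-- `∂_σ : X × X → [0, ∞]`. -/
def pdist (σ : GroupSeminorm G) (x y : X) : ℝ≥0∞ :=
  ⨅ (c : ℝ≥0) (_ : PdistLE σ c x y), (c : ℝ≥0∞)

theorem pdist_le_iff (σ : GroupSeminorm G) (c : ℝ≥0) (x y : X) :
    pdist σ x y ≤ c ↔ PdistLE σ c x y := by
  constructor
  · intro h ε hε A hA hx
    have hlt : pdist σ x y < ((c + ⟨ε, hε.le⟩ : ℝ≥0) : ℝ≥0∞) := by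
      refine lt_of_le_of_lt h ?_
      rw [ENNReal.coe_lt_coe]
      exact lt_add_of_pos_right c (show (0 : ℝ≥0) < ⟨ε, hε.le⟩ from hε)
    unfold pdist at hlt
    simp only [iInf_lt_iff, ENNReal.coe_lt_coe] at hlt
    obtain ⟨d, hd, hdc⟩ := hlt
    have hdc' : (d : ℝ) < c + ε := by exact_mod_cast hdc
    have := hd (c + ε - d) (by linarith) A hA hx
    simpa using this
  · intro h
    exact iInf₂_le c h

theorem PdistLE.symm {σ : GroupSeminorm G} {c : ℝ≥0} {x y : X} (h : PdistLE σ c x y) :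
    PdistLE σ c y x := by
  intro ε hε B hB hy
  rw [mem_closure_iff]
  intro A hA hx
  obtain ⟨z, hzB, g, hg, a, ha, rfl⟩ := mem_closure_iff.1 (h ε hε A hA hx) B hB hy
  refine ⟨a, ha, g⁻¹, ?_, g • a, hzB, by simp⟩
  simpa [snBall] using hg

theorem pdist_symm (σ : GroupSeminorm G) (x y : X) : pdist σ x y = pdist σ y x := by
  have : ∀ x y : X, pdist σ x y ≤ pdist σ y x := fun x y =>
    le_iInf₂ fun c h => iInf₂_le c h.symm
  exact le_antisymm (this x y) (this y x)

theorem pdist_self (σ : GroupSeminorm G) (x : X) : pdist σ x x = 0 := by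
  refine le_antisymm ?_ bot_le
  refine (pdist_le_iff σ 0 x x).2 fun ε hε A _ hx => subset_closure ⟨1, ?_, x, hx, by simp⟩
  simpa [snBall] using hε

variable [ContinuousConstSMul G X]

theorem snBall_smul_closure (σ : GroupSeminorm G) (c d : ℝ) (A : Set X) :
    snBall σ c • closure (snBall σ d • A) ⊆ closure (snBall σ (c + d) • A) := by
  rintro _ ⟨g, hg, z, hz, rfl⟩
  have hz' : g • z ∈ closure ((g • ·) '' (snBall σ d • A)) :=
    image_closure_subset_closure_image (continuous_const_smul g) ⟨z, hz, rfl⟩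
  refine closure_mono ?_ hz'
  rintro _ ⟨_, ⟨k, hk, a, ha, rfl⟩, rfl⟩
  refine ⟨g * k, ?_, a, ha, by simp [mul_smul]⟩
  have h1 : σ g < c := hg
  have h2 : σ k < d := hk
  have h3 : σ (g * k) ≤ σ g + σ k := map_mul_le_add σ g k
  show σ (g * k) < c + d
  linarith

variable [TopologicalSpace G]

theorem PdistLE.trans (hX : IsGED G X) {σ : GroupSeminorm G} (hσ : σ ∈ SN G) {c d : ℝ≥0}
    {x y z : X} (h : PdistLE σ c x y) (h' : PdistLE σ d y z) : PdistLE σ (c + d) x z := by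
  intro ε hε A hA hx
  have hε4 : 0 < ε / 4 := by linarith
  have hopen : IsOpen (snBall σ (c + ε / 4) • A) := hA.smul_left
  have hy : y ∈ interior (closure (snBall σ (ε / 4) • (snBall σ (c + ε / 4) • A))) :=
    hX σ hσ _ hε4 _ hopen (h _ hε4 A hA hx)
  have hz := h' (ε / 4) hε4 _ isOpen_interior hy
  have hsub : snBall σ (d + ε / 4) •
      interior (closure (snBall σ (ε / 4) • (snBall σ (c + ε / 4) • A))) ⊆
      closure (snBall σ ((d + ε / 4) + (ε / 4 + (c + ε / 4))) • A) := by
    refine Subset.trans (smul_subset_smul_left ?_) (snBall_smul_closure σ _ _ A)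
    refine interior_subset.trans (closure_minimal ?_ isClosed_closure)
    exact Subset.trans (smul_subset_smul_left subset_closure) (snBall_smul_closure σ _ _ A)
  have hz' := closure_minimal hsub isClosed_closure hz
  refine closure_mono (smul_subset_smul_right ?_) hz'
  intro g hg
  have hg' : σ g < (d + ε / 4) + (ε / 4 + (c + ε / 4)) := hg
  show σ g < ((c + d : ℝ≥0) : ℝ) + ε
  push_cast
  linarith

theorem pdist_triangle (hX : IsGED G X) {σ : GroupSeminorm G} (hσ : σ ∈ SN G) (x y z : X) :
    pdist σ x z ≤ pdist σ x y + pdist σ y z := by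
  refine ENNReal.le_of_forall_pos_le_add fun ε hε hfin => ?_
  obtain ⟨h1, h2⟩ := ENNReal.add_lt_top.1 hfin
  have e1 : pdist σ x y = ((pdist σ x y).toNNReal : ℝ≥0∞) := (ENNReal.coe_toNNReal h1.ne).symm
  have e2 : pdist σ y z = ((pdist σ y z).toNNReal : ℝ≥0∞) := (ENNReal.coe_toNNReal h2.ne).symm
  have := (pdist_le_iff σ _ x z).2
    (((pdist_le_iff σ _ x y).1 e1.le).trans hX hσ ((pdist_le_iff σ _ y z).1 e2.le))
  rw [ENNReal.coe_add, ← e1, ← e2] at this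
  exact this.trans le_self_add

/-- The equivalence relation `∂_σ(x, y) = 0` on a `G`-ED space. -/
def pdistSetoid (hX : IsGED G X) {σ : GroupSeminorm G} (hσ : σ ∈ SN G) : Setoid X where
  r x y := pdist σ x y = 0
  iseqv :=
    { refl := pdist_self σ
      symm := fun {x y} h => by rw [pdist_symm, h]
      trans := fun {x y z} h h' => by
        have := pdist_triangle hX hσ x y z
        rw [h, h', add_zero] at this
        exact le_antisymm this bot_le }

/-- The quotient `X / ∂_σ`, with the quotient topology. -/
abbrev PdistQuotient (hX : IsGED G X) {σ : GroupSeminorm G} (hσ : σ ∈ SN G) : Type v :=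
  Quotient (pdistSetoid hX hσ)

/-- The metric which `∂_σ` induces on `X / ∂_σ`. -/
def quotientPdist (hX : IsGED G X) {σ : GroupSeminorm G} (hσ : σ ∈ SN G) :
    PdistQuotient hX hσ → PdistQuotient hX hσ → ℝ≥0∞ :=
  Quotient.lift₂ (pdist σ) (by
    have key : ∀ a b a' b' : X, pdist σ a a' = 0 → pdist σ b b' = 0 →
        pdist σ a b ≤ pdist σ a' b' := by
      intro a b a' b' h1 h2
      calc pdist σ a b ≤ pdist σ a a' + pdist σ a' b := pdist_triangle hX hσ _ _ _
        _ ≤ pdist σ a a' + (pdist σ a' b' + pdist σ b' b) := by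
            gcongr; exact pdist_triangle hX hσ _ _ _
        _ = pdist σ a' b' := by rw [pdist_symm σ b' b, h1, h2]; simp
    intro a b a' b' h1 h2
    refine le_antisymm (key a b a' b' h1 h2) (key a' b' a b ?_ ?_)
    · rw [pdist_symm]; exact h1
    · rw [pdist_symm]; exact h2)

end Pseudometric

/-! ### Near ultrafilters and the Gleason completion -/

section NearUltrafilters

variable (G : Type u) [Group G] [TopologicalSpace G]
variable {Z : Type v} [TopologicalSpace Z] [MulAction G Z]

/-- A family of open subsets of the `G`-space `Z` with finite near intersections: for all
finitely many members `A₁, …, Aₙ` and all identity neighbourhoods `U`, the intersection of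
`U A₁, …, U Aₙ` is non-empty. -/
def NearFIP (p : Set (Set Z)) : Prop :=
  (∀ A ∈ p, IsOpen A) ∧
    ∀ F ⊆ p, F.Finite → ∀ U ∈ 𝓝 (1 : G), (⋂ A ∈ F, U • A).Nonempty

variable (Z)

/-- The set underlying the Gleason completion `S_G(Z)` of the `G`-space `Z`: the near ultrafilters,
that is, the maximal families of (non-empty) open sets with finite near intersections. -/
structure GleasonCompletion where
  carrier : Set (Set Z)
  maximal : Maximal (NearFIP G) carrier

variable {G Z}

namespace GleasonCompletion

instance : Membership (Set Z) (GleasonCompletion G Z) := ⟨fun p A => A ∈ p.carrier⟩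

/-- The sets `N_A = {p : A ∉ p}`, for `A` open, form a base of the topology of `S_G(Z)`. -/
instance : TopologicalSpace (GleasonCompletion G Z) :=
  TopologicalSpace.generateFrom {N | ∃ A : Set Z, IsOpen A ∧ N = {p | A ∉ p}}

@[ext] theorem ext {p q : GleasonCompletion G Z} (h : p.carrier = q.carrier) : p = q := by
  cases p; cases q; simpa using h

theorem nearFIP_translate [IsTopologicalGroup G] [ContinuousConstSMul G Z] (g : G)
    {p : Set (Set Z)} (hp : NearFIP G p) : NearFIP G {A : Set Z | (g • ·) ⁻¹' A ∈ p} := by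
  refine ⟨fun A hA => ?_, fun F hF hFf U hU => ?_⟩
  · have h1 := (hp.1 _ hA).preimage (continuous_const_smul (g⁻¹ : G))
    have h2 : (fun z : Z => g⁻¹ • z) ⁻¹' ((fun z : Z => g • z) ⁻¹' A) = A := by
      ext z; simp
    rwa [h2] at h1
  · have hV : {h : G | g * h * g⁻¹ ∈ U} ∈ 𝓝 (1 : G) := by
      have hc : Continuous fun h : G => g * h * g⁻¹ := by fun_prop
      exact hc.continuousAt.preimage_mem_nhds (by simpa using hU)
    obtain ⟨z, hz⟩ := hp.2 ((fun A : Set Z => (g • ·) ⁻¹' A) '' F)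
      (by rintro _ ⟨A, hA, rfl⟩; exact hF hA) (hFf.image _) _ hV
    refine ⟨g • z, ?_⟩
    simp only [mem_iInter] at hz ⊢
    intro A hA
    obtain ⟨h, hh, a, ha, rfl⟩ := hz _ ⟨A, hA, rfl⟩
    exact ⟨g * h * g⁻¹, hh, g • a, ha, by simp [mul_smul]⟩

/-- The action of `G` on `S_G(Z)` by translation: `g p = {g A : A ∈ p}`, that is,
`A ∈ g p` iff `g⁻¹ A ∈ p`. -/
instance [IsTopologicalGroup G] [ContinuousConstSMul G Z] :
    MulAction G (GleasonCompletion G Z) where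
  smul g p :=
    { carrier := {A : Set Z | (g • ·) ⁻¹' A ∈ p.carrier}
      maximal := by
        refine ⟨nearFIP_translate g p.maximal.1, fun q hq hle A hA => ?_⟩
        have h1 := p.maximal.2 (nearFIP_translate g⁻¹ hq) (fun B hB => by
          refine hle ?_
          show (fun z : Z => g • z) ⁻¹' ((fun z : Z => g⁻¹ • z) ⁻¹' B) ∈ p.carrier
          have : (fun z : Z => g • z) ⁻¹' ((fun z : Z => g⁻¹ • z) ⁻¹' B) = B := by ext z; simp
          rwa [this])
        refine h1 ?_
        show (fun z : Z => g⁻¹ • z) ⁻¹' ((fun z : Z => g • z) ⁻¹' A) ∈ q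
        have : (fun z : Z => g⁻¹ • z) ⁻¹' ((fun z : Z => g • z) ⁻¹' A) = A := by ext z; simp
        rwa [this] }
  one_smul p := by
    ext A
    show (fun z : Z => (1 : G) • z) ⁻¹' A ∈ p.carrier ↔ _
    simp
  mul_smul g h p := by
    ext A
    show (fun z : Z => (g * h) • z) ⁻¹' A ∈ p.carrier ↔
      (fun z : Z => h • z) ⁻¹' ((fun z : Z => g • z) ⁻¹' A) ∈ p.carrier
    simp only [mul_smul, preimage_preimage]

theorem mem_smul_iff [IsTopologicalGroup G] [ContinuousConstSMul G Z] (g : G)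
    (p : GleasonCompletion G Z) (A : Set Z) : A ∈ g • p ↔ (g • ·) ⁻¹' A ∈ p := Iff.rfl

theorem exists_of_not_mem (p : GleasonCompletion G Z) {A : Set Z} (hA : IsOpen A) (h : A ∉ p) :
    ∃ F ⊆ p.carrier, F.Finite ∧ ∃ U ∈ 𝓝 (1 : G), (⋂ B ∈ F, U • B) ∩ U • A = ∅ := by
  by_contra! hcon
  refine h (p.maximal.2 (y := insert A p.carrier) ⟨?_, ?_⟩ (subset_insert _ _) (mem_insert _ _))
  · rintro B (rfl | hB)
    · exact hA
    · exact p.maximal.1.1 B hB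
  · intro F hF hFf U hU
    obtain ⟨z, hz, hzA⟩ := hcon (F \ {A})
      (fun B hB => (hF hB.1).resolve_left hB.2) (hFf.subset sdiff_subset) U hU
    refine ⟨z, ?_⟩
    simp only [mem_iInter] at hz ⊢
    intro B hB
    by_cases hBA : B = A
    · rw [hBA]; exact hzA
    · exact hz B ⟨hB, hBA⟩

theorem mem_or_mem_of_union_mem (p : GleasonCompletion G Z) {A B : Set Z} (hA : IsOpen A)
    (hB : IsOpen B) (h : A ∪ B ∈ p) : A ∈ p ∨ B ∈ p := by
  by_contra! hcon
  obtain ⟨F, hF, hFf, U, hU, hFU⟩ := p.exists_of_not_mem hA hcon.1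
  obtain ⟨E, hE, hEf, V, hV, hEV⟩ := p.exists_of_not_mem hB hcon.2
  obtain ⟨z, hz⟩ := p.maximal.1.2 (insert (A ∪ B) (F ∪ E))
    (insert_subset h (union_subset hF hE)) ((hFf.union hEf).insert _) (U ∩ V) (inter_mem hU hV)
  simp only [mem_iInter] at hz
  obtain ⟨g, hg, a, ha | ha, rfl⟩ := hz _ (mem_insert _ _)
  · refine (eq_empty_iff_forall_notMem.1 hFU) (g • a) ⟨?_, ⟨g, hg.1, a, ha, rfl⟩⟩
    simp only [mem_iInter]
    exact fun C hC => smul_subset_smul_right inter_subset_left (hz C (.inr (.inl hC)))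
  · refine (eq_empty_iff_forall_notMem.1 hEV) (g • a) ⟨?_, ⟨g, hg.2, a, ha, rfl⟩⟩
    simp only [mem_iInter]
    exact fun C hC => smul_subset_smul_right inter_subset_right (hz C (.inr (.inr hC)))

theorem univ_mem (p : GleasonCompletion G Z) : univ ∈ p := by
  by_contra h
  obtain ⟨F, hF, hFf, U, hU, hFU⟩ := p.exists_of_not_mem isOpen_univ h
  obtain ⟨z, hz⟩ := p.maximal.1.2 F hF hFf U hU
  exact (eq_empty_iff_forall_notMem.1 hFU) z ⟨hz, ⟨1, mem_of_mem_nhds hU, z, trivial, by simp⟩⟩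

theorem exists_mem_of_biUnion_mem (p : GleasonCompletion G Z) {κ : Type w} (t : Finset κ)
    (A : κ → Set Z) (hA : ∀ k ∈ t, IsOpen (A k)) (h : (⋃ k ∈ t, A k) ∈ p) : ∃ k ∈ t, A k ∈ p := by
  classical
  induction t using Finset.induction_on with
  | empty =>
    exfalso
    obtain ⟨z, hz⟩ := p.maximal.1.2 {⋃ k ∈ (∅ : Finset κ), A k} (by
        rintro _ rfl
        exact h) (finite_singleton _) univ Filter.univ_mem
    simp at hz
  | insert k t _ ih =>
    rw [Finset.set_biUnion_insert] at h
    rcases p.mem_or_mem_of_union_mem (hA k (Finset.mem_insert_self k t))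
      (isOpen_biUnion fun j hj => hA j (Finset.mem_insert_of_mem hj)) h with h | h
    · exact ⟨k, Finset.mem_insert_self k t, h⟩
    · obtain ⟨j, hj, hjp⟩ := ih (fun j hj => hA j (Finset.mem_insert_of_mem hj)) h
      exact ⟨j, Finset.mem_insert_of_mem hj, hjp⟩

end GleasonCompletion

end NearUltrafilters

/-! ### Ultracopowers -/

section Ultracopower

variable {G : Type u} [Group G] [TopologicalSpace G]
variable {I : Type w} {X : Type v} [TopologicalSpace X] [MulAction G X]

instance sigmaContinuousConstSMul [ContinuousConstSMul G X] :
    ContinuousConstSMul G (Σ _ : I, X) where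
  continuous_const_smul g := by
    refine continuous_sigma fun i => ?_
    exact continuous_sigmaMk.comp (continuous_const_smul g)

/-- For a flow `X` and `p ∈ S_G(I × X)`, there is exactly one `x ∈ X` all of whose open
neighbourhoods `A` satisfy `I × A ∈ p`. (The `G`-space `I × X`, with `I` discrete and `G` acting
on the second coordinate, is the disjoint union of copies of `X` indexed by `I`.) -/
theorem existsUnique_proj [CompactSpace X] [T2Space X] [ContinuousSMul G X]
    (p : GleasonCompletion G (Σ _ : I, X)) :
    ∃! x : X, ∀ A : Set X, IsOpen A → x ∈ A → Sigma.snd ⁻¹' A ∈ p := by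
  have hsnd : Continuous (Sigma.snd : (Σ _ : I, X) → X) := continuous_sigma fun _ => continuous_id
  have hex : ∃ x : X, ∀ A : Set X, IsOpen A → x ∈ A → Sigma.snd ⁻¹' A ∈ p := by
    by_contra! hcon
    choose A hAo hxA hAp using hcon
    obtain ⟨t, ht⟩ := isCompact_univ.elim_finite_subcover A hAo
      (fun x _ => mem_iUnion.2 ⟨x, hxA x⟩)
    have : (⋃ x ∈ t, (Sigma.snd ⁻¹' A x : Set (Σ _ : I, X))) = univ := by
      ext z
      simpa using ht (mem_univ z.2)
    obtain ⟨x, -, hx⟩ := p.exists_mem_of_biUnion_mem t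
      (fun x => (Sigma.snd ⁻¹' A x : Set (Σ _ : I, X))) (fun x _ => (hAo x).preimage hsnd)
      (by rw [this]; exact p.univ_mem)
    exact hAp x hx
  obtain ⟨x, hx⟩ := hex
  refine ⟨x, hx, fun y hy => ?_⟩
  by_contra hne
  obtain ⟨B, A, hB, hA, hyB, hxA, hd⟩ := t2_separation hne
  have sep : ∀ (z : X) (C : Set X), IsOpen C → z ∈ C →
      ∃ U ∈ 𝓝 (1 : G), ∃ D : Set X, IsOpen D ∧ z ∈ D ∧ U • D ⊆ C := by
    intro z C hC hz
    have : (fun q : G × X => q.1 • q.2) ⁻¹' C ∈ 𝓝 ((1 : G), z) :=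
      continuous_smul.continuousAt.preimage_mem_nhds (by simpa using hC.mem_nhds hz)
    rw [nhds_prod_eq, mem_prod_iff] at this
    obtain ⟨U, hU, D', hD', hsub⟩ := this
    obtain ⟨D, hDD, hD, hzD⟩ := mem_nhds_iff.1 hD'
    refine ⟨U, hU, D, hD, hzD, ?_⟩
    rintro _ ⟨g, hg, d, hd, rfl⟩
    exact hsub (show (g, d) ∈ U ×ˢ D' from ⟨hg, hDD hd⟩)
  obtain ⟨U, hU, D, hD, hyD, hUD⟩ := sep y B hB hyB
  obtain ⟨V, hV, E, hE, hxE, hVE⟩ := sep x A hA hxA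
  obtain ⟨z, hz⟩ := p.maximal.1.2 {Sigma.snd ⁻¹' D, Sigma.snd ⁻¹' E}
    (by
      rintro _ (rfl | rfl)
      · exact hy D hD hyD
      · exact hx E hE hxE) (by simp) (U ∩ V) (inter_mem hU hV)
  simp only [mem_iInter] at hz
  have h1 : z.2 ∈ B := by
    obtain ⟨g, hg, d, hd, rfl⟩ := hz _ (.inl rfl)
    exact hUD ⟨g, hg.1, d.2, hd, rfl⟩
  have h2 : z.2 ∈ A := by
    obtain ⟨g, hg, d, hd, rfl⟩ := hz _ (.inr rfl)
    exact hVE ⟨g, hg.2, d.2, hd, rfl⟩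
  exact disjoint_left.1 hd h1 h2

variable (G X) in
/-- The `G`-ultracopower of `X` along `𝒰 ∈ βI`: the set of all `p ∈ S_G(I × X)` such that
`S × X ∈ p` for every `S ∈ 𝒰`, with the subspace topology. -/
def Ultracopower (𝒰 : Ultrafilter I) : Type (max v w) :=
  {p : GleasonCompletion G (Σ _ : I, X) // ∀ S ∈ 𝒰, Sigma.fst ⁻¹' S ∈ p}

instance (𝒰 : Ultrafilter I) : TopologicalSpace (Ultracopower G X 𝒰) :=
  instTopologicalSpaceSubtype

instance [IsTopologicalGroup G] [ContinuousConstSMul G X] (𝒰 : Ultrafilter I) :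
    MulAction G (Ultracopower G X 𝒰) where
  smul g p := ⟨g • p.1, fun S hS => p.2 S hS⟩
  one_smul p := Subtype.ext (one_smul G p.1)
  mul_smul g h p := Subtype.ext (mul_smul g h p.1)

/-- The ultracopower map `Σ_𝒰^G X → X`, the restriction of the continuous extension to
`S_G(I × X)` of the projection `I × X → X`: it sends `p` to the unique `x` such that `I × A ∈ p`
for all open `A ∋ x`. -/
def ultracopowerMap [CompactSpace X] [T2Space X] [ContinuousSMul G X] (𝒰 : Ultrafilter I)
    (p : Ultracopower G X 𝒰) : X :=
  (existsUnique_proj p.1).choose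

end Ultracopower

/-! ### Subflows and highly proximal maps -/

section Subflows

variable (G : Type u) [Group G] {Y : Type v} [TopologicalSpace Y] [MulAction G Y]

/-- A subflow: a non-empty compact `G`-invariant subset. -/
def IsSubflow (M : Set Y) : Prop :=
  M.Nonempty ∧ IsCompact M ∧ ∀ g : G, ∀ y ∈ M, g • y ∈ M

/-- A minimal subflow: a subflow that properly contains no subflow. -/
def IsMinimalSubflow (M : Set Y) : Prop := Minimal (IsSubflow G) M

variable {X : Type w} [TopologicalSpace X] [MulAction G X]

/-- `π : Y → X` is a highly proximal factor map: it is a continuous equivariant surjection and, for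
every `x`, some net of translates `g π⁻¹[x]` of the fibre converges, in the Vietoris topology, to a
singleton. (The net is given by a proper filter on `G`.) -/
def IsHighlyProximal (π : Y → X) : Prop :=
  Continuous π ∧ (∀ (g : G) (y : Y), π (g • y) = g • π y) ∧ Function.Surjective π ∧
    ∀ x : X, ∃ l : Filter G, l.NeBot ∧ ∃ y : Y,
      Tendsto (fun g : G => g • (π ⁻¹' {x})) l (@nhds _ (TopologicalSpace.vietoris Y) {y})

end Subflows

end GFlow

end

open GFlow

namespace GFlow

universe u v w

/-! ### Birkhoff–Kakutani: enough continuous semi-norms. -/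

section BirkhoffKakutani

variable {G : Type u} [Group G] [TopologicalSpace G]

/-! The pivot is the existence of `U`-TT open sets.

Compatibility. Any two points of a `B_σ(c)`-TT set are at `∂_σ`-distance at most `c`
(`IsUTT.pdist_le`). So under the Rosendal criterion the unions of the `B_σ(1/(n+1))`-TT sets are
dense and open, and Baire category yields a dense set of compatible points. Conversely, `G`-ED gives
the triangle inequality, so a small neighbourhood of a compatible point is TT; Birkhoff–Kakutani
passes from semi-norms to arbitrary `U`. The quotient sees the same points because small
`σ`-fattenings of open sets contain open `∂_σ`-saturated sets (`pdistHull`).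

Minimality. Finitely many translates of any non-empty open set cover `X`. Hence one TT set can be
moved into every open set, and it also gives thickness. If no set is `U`-TT, finitely many pairs of
translates can be separated by successive shrinking, which refutes thickness.

Ultracopowers. Over a `U`-TT set, points of an ultracopower agree up to `U`
(`Ultracopower.smul_mem_of_isUTT`). Moving a fibre over `U`-TT sets as `U` shrinks collapses it to a
point, so the map is highly proximal. Every subflow meets every fibre, so it contains this limit
point, and there is only one minimal subflow. Finally, if thickness fails, witnesses `A_F`, `B_F`
indexed by the finite sets `F` give two disjoint subflows of one ultracopower. -/

theorem snBall_mem_nhds_one {σ : GroupSeminorm G} (hσ : σ ∈ SN G) {c : ℝ} (hc : 0 < c) :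
    snBall σ c ∈ 𝓝 (1 : G) :=
  (isOpen_lt hσ.1 continuous_const).mem_nhds (by simpa using hc)

variable [IsTopologicalGroup G]

theorem continuous_groupSeminorm {σ : GroupSeminorm G}
    (h : ∀ ε : ℝ, 0 < ε → snBall σ ε ∈ 𝓝 (1 : G)) : Continuous σ := by
  refine continuous_iff_continuousAt.2 fun a => Metric.tendsto_nhds.2 fun ε hε => ?_
  have hc : Continuous fun g : G => a⁻¹ * g := by fun_prop
  have := hc.continuousAt.preimage_mem_nhds (x := a) (by simpa using h ε hε)
  filter_upwards [this] with g hg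
  have h1 : σ (a⁻¹ * g) < ε := hg
  have h2 : σ g ≤ σ a + σ (a⁻¹ * g) := by simpa using map_mul_le_add σ a (a⁻¹ * g)
  have h3 : σ a ≤ σ g + σ (a⁻¹ * g) := by
    have := map_mul_le_add σ g (a⁻¹ * g)⁻¹
    rw [map_inv_eq_map] at this
    simpa using this
  rw [Real.dist_eq, abs_lt]
  constructor <;> linarith

/-- Three factors, since the chain estimate `PseudoMetricSpace.le_two_mul_dist_ofPreNNDist` compares
a four-point path with its endpoints. -/
theorem exists_symm_nhds_one_mul_mul_subset {U : Set G} (hU : U ∈ 𝓝 (1 : G)) :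
    ∃ V ∈ 𝓝 (1 : G), V⁻¹ = V ∧ V * V * V ⊆ U := by
  obtain ⟨V, hV, -, -, hVU⟩ := exists_closed_nhds_one_inv_eq_mul_subset hU
  obtain ⟨W, hW, -, hWi, hWV⟩ := exists_closed_nhds_one_inv_eq_mul_subset hV
  have hWsub : W ⊆ V := fun w hw => hWV ⟨w, hw, 1, mem_of_mem_nhds hW, by simp⟩
  exact ⟨W, hW, hWi, (mul_subset_mul hWV hWsub).trans hVU⟩

theorem exists_seq_symm_nhds_one {U : Set G} (hU : U ∈ 𝓝 (1 : G)) :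
    ∃ V : ℕ → Set G, V 0 ⊆ U ∧ (∀ n, V n ∈ 𝓝 (1 : G)) ∧ (∀ n, (V n)⁻¹ = V n) ∧
      ∀ n, V (n + 1) * V (n + 1) * V (n + 1) ⊆ V n := by
  choose! f hf hfi hfm using fun (W : Set G) => exists_symm_nhds_one_mul_mul_subset (U := W)
  let V : ℕ → Set G := fun n => Nat.rec (f U) (fun _ W => f W) n
  have hV : ∀ n, V n ∈ 𝓝 (1 : G) := by
    intro n
    induction n with
    | zero => exact hf U hU
    | succ n ih => exact hf _ ih
  have h1 : (1 : G) ∈ f U := mem_of_mem_nhds (hV 0)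
  refine ⟨V, fun g hg => hfm U hU ⟨1 * 1, ⟨1, h1, 1, h1, rfl⟩, g, hg, by simp⟩, hV, ?_,
    fun n => hfm _ (hV n)⟩
  rintro (_ | n)
  · exact hfi U hU
  · exact hfi _ (hV n)

/-- Birkhoff–Kakutani: the balls of bounded continuous semi-norms form a neighbourhood base at the
identity. -/
theorem exists_snBall_subset {U : Set G} (hU : U ∈ 𝓝 (1 : G)) :
    ∃ σ ∈ SN G, ∃ ε : ℝ, 0 < ε ∧ snBall σ ε ⊆ U := by
  classical
  obtain ⟨V, hVU, hV, hVi, hVm⟩ := exists_seq_symm_nhds_one hU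
  have hone : ∀ n, (1 : G) ∈ V n := fun n => mem_of_mem_nhds (hV n)
  have hanti : Antitone V := antitone_nat_of_succ_le fun n g hg =>
    hVm n ⟨1 * 1, ⟨1, hone _, 1, hone _, rfl⟩, g, hg, by simp⟩
  -- The exponent is the first `n` with `g ∉ V n`; the value is `0` on the intersection of all `V
  -- n`.
  let f : G → ℝ≥0 := fun g => if h : ∃ n, g ∉ V n then (1 / 2) ^ Nat.find h else 0
  have hr : (1 / 2 : ℝ≥0) ∈ Ioo (0 : ℝ≥0) 1 := ⟨half_pos one_pos, NNReal.half_lt_self one_ne_zero⟩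
  have hf1 : f 1 = 0 := dif_neg (by simpa using hone)
  have hfinv : ∀ g, f g⁻¹ = f g := by
    intro g
    have : ∀ n, g⁻¹ ∉ V n ↔ g ∉ V n := fun n => by rw [← Set.mem_inv, hVi]
    simp only [f, this]
  have hfle : ∀ {g : G} {n : ℕ}, (1 / 2) ^ n ≤ f g ↔ g ∉ V n := by
    intro g n
    dsimp only [f]
    split_ifs with h
    · rw [(pow_right_strictAnti₀ hr.1 hr.2).le_iff_ge, Nat.find_le_iff]
      exact ⟨fun ⟨m, hmn, hm⟩ hn => hm (hanti hmn hn), fun h => ⟨n, le_rfl, h⟩⟩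
    · push Not at h
      simp only [h, not_true, (pow_pos hr.1 _).not_ge]
  let d : G → G → ℝ≥0 := fun x y => f (x⁻¹ * y)
  have hdself : ∀ x, d x x = 0 := fun x => by simp [d, hf1]
  have hdcomm : ∀ x y, d x y = d y x := fun x y => by
    simp only [d]; rw [← hfinv]; simp
  -- The chain infimum of `d` is a pseudometric that differs from `d` by a factor of at most `2`.
  let I := PseudoMetricSpace.ofPreNNDist d hdself hdcomm
  have hdist_le : ∀ x y, I.dist x y ≤ d x y := PseudoMetricSpace.dist_ofPreNNDist_le _ _ _
  have hle_dist : ∀ x y, (d x y : ℝ) ≤ 2 * I.dist x y := by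
    refine PseudoMetricSpace.le_two_mul_dist_ofPreNNDist _ _ _ fun x₁ x₂ x₃ x₄ => ?_
    by_cases H : ∃ n, x₁⁻¹ * x₄ ∉ V n
    · refine (dif_pos H).trans_le ?_
      rw [← div_le_iff₀' zero_lt_two, ← mul_one_div (_ ^ _), ← pow_succ]
      simp only [le_max_iff, d, hfle, ← not_and_or]
      rintro ⟨h₁₂, h₂₃, h₃₄⟩
      refine Nat.find_spec H (hVm (Nat.find H) ?_)
      exact ⟨_, ⟨_, h₁₂, _, h₂₃, rfl⟩, _, h₃₄, by group⟩
    · exact (dif_neg H).trans_le zero_le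
  -- Left translation permutes the chains and preserves `d`. Left invariance is what makes the
  -- distance to `1` a semi-norm.
  have hinv : ∀ g x y : G, I.dist (g * x) (g * y) = I.dist x y := by
    intro g x y
    have hs : Function.Surjective (List.map (g * ·)) :=
      List.map_surjective_iff.2 (mul_left_surjective g)
    refine NNReal.coe_inj.2 (hs.iInf_congr _ fun l => ?_).symm
    have h1 : g * x :: l.map (g * ·) = (x :: l).map (g * ·) := rfl
    have h2 : l.map (g * ·) ++ [g * y] = (l ++ [y]).map (g * ·) := by simp
    rw [h1, h2, List.zipWith_map]
    simp [d, mul_assoc]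
  let σ : GroupSeminorm G :=
    { toFun := fun g => I.dist 1 g
      map_one' := I.dist_self 1
      mul_le' := fun g h => by
        have := I.dist_triangle 1 g (g * h)
        rwa [show I.dist g (g * h) = I.dist 1 h by simpa using hinv g 1 h] at this
      inv' := fun g => by
        have := hinv g 1 g⁻¹
        rw [mul_one, mul_inv_cancel] at this
        rw [← this]; exact I.dist_comm _ _ }
  have hσf : ∀ g, σ g ≤ f g := fun g => by
    have := hdist_le 1 g
    simp only [d, inv_one, one_mul] at this
    exact this
  have hfσ : ∀ g, (f g : ℝ) ≤ 2 * σ g := fun g => by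
    have := hle_dist 1 g
    simp only [d, inv_one, one_mul] at this
    exact this
  refine ⟨σ, ⟨continuous_groupSeminorm fun ε hε => ?_, 1, fun g => (hσf g).trans ?_⟩, 1 / 2,
    by norm_num, fun g hg => hVU ?_⟩
  · obtain ⟨n, hn⟩ := exists_pow_lt_of_lt_one hε (show (1 / 2 : ℝ) < 1 by norm_num)
    refine mem_of_superset (hV n) fun g hg => ?_
    have : f g < (1 / 2) ^ n := not_le.1 fun h => hfle.1 h hg
    have h2 : (f g : ℝ) < (1 / 2) ^ n := by exact_mod_cast this
    exact (hσf g).trans_lt (h2.trans hn)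
  · have : f g ≤ 1 := by
      dsimp only [f]
      split_ifs
      · exact pow_le_one₀ zero_le hr.2.le
      · exact zero_le
    exact_mod_cast this
  · by_contra h
    have h1 : (1 : ℝ≥0) ≤ f g := by simpa using hfle.2 h
    have h2 : (1 : ℝ) ≤ f g := by exact_mod_cast h1
    have h3 : σ g < 1 / 2 := hg
    linarith [hfσ g]

theorem isSNBase_SN : IsSNBase (SN G) := by
  refine ⟨Subset.rfl, ⟨fun U => ⟨fun hU => ?_, ?_⟩⟩⟩
  · obtain ⟨σ, hσ, ε, hε, h⟩ := exists_snBall_subset hU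
    exact ⟨(σ, ε), ⟨hσ, hε⟩, h⟩
  · rintro ⟨⟨σ, ε⟩, ⟨hσ, hε⟩, h⟩
    exact mem_of_superset (snBall_mem_nhds_one hσ hε) h

end BirkhoffKakutani

/-! ### `U`-TT sets, the Rosendal criterion and thickness. -/

section TopologicalTransitivity

variable {G : Type u} [Group G] {X : Type v} [TopologicalSpace X]
  [MulAction G X]

theorem isUTT_iff {U : Set G} {A : Set X} :
    IsUTT U A ↔ IsOpen A ∧ A.Nonempty ∧ ∀ B C : Set X, B ⊆ A → C ⊆ A → IsOpen B → IsOpen C →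
      B.Nonempty → C.Nonempty → ((U • B) ∩ C).Nonempty := by
  refine ⟨fun h => ⟨h.1, h.2.1, fun B C hBA hCA hB hC hBn hCn => ?_⟩,
    fun h => ⟨h.1, h.2.1, fun B hBA hB hBn a ha => ?_⟩⟩
  · obtain ⟨c, hc⟩ := hCn
    obtain ⟨z, hz, hz'⟩ := mem_closure_iff.1 (h.2.2 B hBA hB hBn (hCA hc)) C hC hc
    exact ⟨z, hz', hz⟩
  · refine mem_closure_iff.2 fun C hC haC => ?_
    obtain ⟨z, hz, hz'⟩ := h.2.2 B (C ∩ A) hBA inter_subset_right hB (hC.inter h.1) hBn ⟨a, haC, ha⟩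
    exact ⟨z, hz'.1, hz⟩

theorem IsUTT.subset {U : Set G} {A B : Set X} (h : IsUTT U A) (hBA : B ⊆ A) (hB : IsOpen B)
    (hBn : B.Nonempty) : IsUTT U B :=
  ⟨hB, hBn, fun C hCB hC hCn => hBA.trans (h.2.2 C (hCB.trans hBA) hC hCn)⟩

theorem IsUTT.mono {U V : Set G} {A : Set X} (h : IsUTT U A) (hUV : U ⊆ V) : IsUTT V A :=
  ⟨h.1, h.2.1, fun B hBA hB hBn =>
    (h.2.2 B hBA hB hBn).trans (closure_mono (smul_subset_smul_right hUV))⟩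

variable [ContinuousConstSMul G X]

theorem IsUTT.smul {U V : Set G} {A : Set X} (h : IsUTT U A) (g : G)
    (hUV : ∀ u ∈ U, g * u * g⁻¹ ∈ V) : IsUTT V (g • A) := by
  refine isUTT_iff.2 ⟨h.1.smul g, h.2.1.smul_set, fun B C hB hC hBo hCo hBn hCn => ?_⟩
  obtain ⟨z, ⟨u, hu, w, ⟨b, hb, hbw⟩, huz⟩, ⟨c, hc, hcz⟩⟩ :=
    (isUTT_iff.1 h).2.2 (g⁻¹ • B) (g⁻¹ • C) (by rwa [← subset_smul_set_iff])
      (by rwa [← subset_smul_set_iff]) (hBo.smul _) (hCo.smul _) hBn.smul_set hCn.smul_set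
  refine ⟨c, ⟨g * u * g⁻¹, hUV u hu, b, hb, ?_⟩, hc⟩
  simp only at hbw huz hcz ⊢
  rw [mul_smul, mul_smul, hbw, huz, ← hcz, smul_inv_smul]

variable [TopologicalSpace G] [IsTopologicalGroup G]

theorem conj_preimage_mem_nhds_one {U : Set G} (hU : U ∈ 𝓝 (1 : G)) (g : G) :
    {u | g * u * g⁻¹ ∈ U} ∈ 𝓝 (1 : G) := by
  have hc : Continuous fun h : G => g * h * g⁻¹ := by fun_prop
  exact hc.continuousAt.preimage_mem_nhds (by simpa using hU)

/-- Finitely many translates of `A` cover `X`. A set that is TT for the intersection of the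
corresponding conjugates of `U` meets one of them, and pulling it back makes it meet `A` while being
`U`-TT. -/
theorem rosendalCriterion_of_somewhereUTT [CompactSpace X] [MulAction.IsMinimal G X]
    (h : ∀ U ∈ 𝓝 (1 : G), SomewhereUTT U (univ : Set X)) : RosendalCriterion G X := by
  intro U hU A hA hAn
  obtain ⟨F, hF⟩ := (isCompact_univ (X := X)).exists_finite_cover_smul G hA hAn
  have hV : (⋂ f ∈ F, {u | f⁻¹ * u * f⁻¹⁻¹ ∈ U}) ∈ 𝓝 (1 : G) :=
    (biInter_finset_mem F).2 fun f _ => conj_preimage_mem_nhds_one hU f⁻¹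
  obtain ⟨A₀, -, hA₀⟩ := h _ hV
  obtain ⟨a, ha⟩ := hA₀.2.1
  obtain ⟨f, hf, haf⟩ := mem_iUnion₂.1 (hF (mem_univ a))
  have h1 : IsUTT U (f⁻¹ • A₀) := hA₀.smul f⁻¹ fun u hu => mem_iInter₂.1 hu f hf
  refine ⟨f⁻¹ • A₀ ∩ A, inter_subset_right, h1.subset inter_subset_left (h1.1.inter hA) ?_⟩
  exact ⟨f⁻¹ • a, smul_mem_smul_set ha, mem_smul_set_iff_inv_smul_mem.1 haf⟩

omit [IsTopologicalGroup G] in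
-- Since finitely many translates of the TT set `A₀` cover `X`, inverse translates of `A` and `B`
-- meet `A₀`, where transitivity joins them.
theorem thicknessCondition_of_somewhereUTT [CompactSpace X] [MulAction.IsMinimal G X]
    (h : ∀ U ∈ 𝓝 (1 : G), SomewhereUTT U (univ : Set X)) : ThicknessCondition G X := by
  classical
  intro U hU
  obtain ⟨A₀, -, hA₀⟩ := h U hU
  obtain ⟨F, hF⟩ := (isCompact_univ (X := X)).exists_finite_cover_smul G hA₀.1 hA₀.2.1
  refine ⟨F.image (·⁻¹), fun A B hA ⟨a, ha⟩ hB ⟨b, hb⟩ => ?_⟩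
  obtain ⟨f, hf, haf⟩ := mem_iUnion₂.1 (hF (mem_univ a))
  obtain ⟨k, hk, hbk⟩ := mem_iUnion₂.1 (hF (mem_univ b))
  obtain ⟨z, ⟨u, hu, w, ⟨⟨x, hx, hxw⟩, -⟩, huz⟩, ⟨⟨y, hy, hyz⟩, -⟩⟩ :=
    (isUTT_iff.1 hA₀).2.2 (f⁻¹ • A ∩ A₀) (k⁻¹ • B ∩ A₀)
    inter_subset_right inter_subset_right ((hA.smul _).inter hA₀.1) ((hB.smul _).inter hA₀.1)
    ⟨f⁻¹ • a, smul_mem_smul_set ha, mem_smul_set_iff_inv_smul_mem.1 haf⟩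
    ⟨k⁻¹ • b, smul_mem_smul_set hb, mem_smul_set_iff_inv_smul_mem.1 hbk⟩
  refine ⟨z, ⟨u, hu, w, ⟨f⁻¹, ?_, x, hx, hxw⟩, huz⟩,
    ⟨1, mem_of_mem_nhds hU, z, ⟨k⁻¹, ?_, y, hy, hyz⟩, one_smul _ _⟩⟩
  · simpa using hf
  · simpa using hk

omit [TopologicalSpace G] [IsTopologicalGroup G] in
/-- If no non-empty open set is `U`-TT, then any two non-empty open sets can be shrunk to two
`V`-separated ones, where `V V ⊆ U`. -/
theorem exists_separated_of_not_somewhereUTT {U V : Set G} (hVi : V⁻¹ = V) (hVU : V * V ⊆ U)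
    (h : ¬ SomewhereUTT U (univ : Set X)) {B C : Set X} (hB : IsOpen B) (hBn : B.Nonempty)
    (hC : IsOpen C) (hCn : C.Nonempty) :
    ∃ B' ⊆ B, ∃ C' ⊆ C, IsOpen B' ∧ B'.Nonempty ∧ IsOpen C' ∧ C'.Nonempty ∧
      ¬ ((V • B') ∩ C').Nonempty := by
  by_contra! hcon
  refine h ⟨B, subset_univ _, isUTT_iff.2 ⟨hB, hBn, fun B₁ B₂ h₁ h₂ ho₁ ho₂ hn₁ hn₂ => ?_⟩⟩
  -- `C` acts as a relay: `V B₁` meets `V B₂ ∩ C`, so an element of `V⁻¹ V ⊆ U` carries a point of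
  -- `B₁` into `B₂`.
  have hD := hcon B₂ h₂ C Subset.rfl ho₂ hn₂ hC hCn
  obtain ⟨z, ⟨v, hv, b, hb, hbz⟩, ⟨w, hw, c, hc, hcz⟩, -⟩ :=
    hcon B₁ h₁ _ inter_subset_right ho₁ hn₁ (ho₂.smul_left.inter hC) hD
  refine ⟨c, ⟨w⁻¹ * v, hVU ⟨w⁻¹, by rwa [← hVi, Set.inv_mem_inv], v, hv, rfl⟩, b, hb, ?_⟩, hc⟩
  simp only at hbz hcz ⊢
  rw [mul_smul, hbz, ← hcz, inv_smul_smul]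

omit [TopologicalSpace G] [IsTopologicalGroup G] in
-- Treat the pairs one at a time: shrinking `A` and `B` for a new pair preserves the separations
-- already obtained.
theorem exists_separated_translates_of_not_somewhereUTT [Nonempty X] {U V : Set G} (hVi : V⁻¹ = V)
    (hVU : V * V ⊆ U) (h : ¬ SomewhereUTT U (univ : Set X)) (E : Finset (G × G)) :
    ∃ A B : Set X, IsOpen A ∧ A.Nonempty ∧ IsOpen B ∧ B.Nonempty ∧
      ∀ e ∈ E, ¬ ((V • e.1 • A) ∩ e.2 • B).Nonempty := by
  classical
  induction E using Finset.induction_on with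
  | empty => exact ⟨univ, univ, isOpen_univ, univ_nonempty, isOpen_univ, univ_nonempty, by simp⟩
  | insert e E _ ih =>
    obtain ⟨A, B, hA, hAn, hB, hBn, hE⟩ := ih
    obtain ⟨A', hA', B', hB', hAo, hAn', hBo, hBn', hd⟩ :=
      exists_separated_of_not_somewhereUTT hVi hVU h (hA.smul e.1) hAn.smul_set (hB.smul e.2)
        hBn.smul_set
    refine ⟨e.1⁻¹ • A', e.2⁻¹ • B', hAo.smul _, hAn'.smul_set, hBo.smul _, hBn'.smul_set,
      fun e' he' => ?_⟩
    rcases Finset.mem_insert.1 he' with rfl | he'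
    · simpa using hd
    · refine fun hne => hE e' he' (hne.mono ?_)
      exact inter_subset_inter
        (smul_subset_smul_left (smul_set_mono (by rwa [← subset_smul_set_iff])))
        (smul_set_mono (by rwa [← subset_smul_set_iff]))

theorem somewhereUTT_of_thicknessCondition [Nonempty X] (h : ThicknessCondition G X) :
    ∀ U ∈ 𝓝 (1 : G), SomewhereUTT U (univ : Set X) := by
  classical
  intro U hU
  by_contra hcon
  obtain ⟨V, hV, -, hVi, hVU⟩ := exists_closed_nhds_one_inv_eq_mul_subset hU
  -- The second halving turns fattenings by `W` on both sides into one fattening by `V`.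
  obtain ⟨W, hW, -, hWi, hWV⟩ := exists_closed_nhds_one_inv_eq_mul_subset hV
  obtain ⟨F, hF⟩ := h W hW
  obtain ⟨A, B, hA, hAn, hB, hBn, hd⟩ :=
    exists_separated_translates_of_not_somewhereUTT hVi hVU hcon (F ×ˢ F)
  obtain ⟨z, ⟨w, hw, x, ⟨f, hf, a, ha, hx⟩, hwx⟩, ⟨t, ht, y, ⟨k, hk, b, hb, hy⟩, hty⟩⟩ :=
    hF A B hA hAn hB hBn
  refine hd (f, k) (Finset.mem_product.2 ⟨hf, hk⟩) ⟨y, ⟨t⁻¹ * w,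
    hWV ⟨t⁻¹, by rwa [← hWi, Set.inv_mem_inv], w, hw, rfl⟩, x, ⟨a, ha, hx⟩, ?_⟩, ⟨b, hb, hy⟩⟩
  simp only at hwx hty ⊢
  rw [mul_smul, hwx, ← hty, inv_smul_smul]

end TopologicalTransitivity

/-! ### Compatible points of `∂_σ` versus `U`-TT sets. -/

section Compatibility

variable {G : Type u} [Group G] {X : Type v} [TopologicalSpace X] [MulAction G X]

theorem IsUTT.pdist_le {σ : GroupSeminorm G} {c : ℝ≥0} {A : Set X} (hA : IsUTT (snBall σ c) A)
    {x y : X} (hx : x ∈ A) (hy : y ∈ A) : pdist σ x y ≤ c := by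
  refine (pdist_le_iff σ c x y).2 fun ε hε B hB hxB => ?_
  have h := hA.2.2 (B ∩ A) inter_subset_right (hB.inter hA.1) ⟨x, hxB, hx⟩ hy
  refine closure_mono (Set.smul_subset_smul (fun g hg => ?_) inter_subset_left) h
  exact lt_of_lt_of_le (show σ g < c from hg) (by linarith)

theorem isClosed_setOf_pdist_le (σ : GroupSeminorm G) (c : ℝ≥0) (x : X) :
    IsClosed {y | pdist σ x y ≤ c} := by
  simp only [pdist_le_iff, PdistLE, ofPred_forall]
  exact isClosed_iInter fun _ => isClosed_iInter fun _ => isClosed_iInter fun _ =>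
    isClosed_iInter fun _ => isClosed_iInter fun _ => isClosed_closure

theorem pdist_smul_le (σ : GroupSeminorm G) {c : ℝ≥0} {g : G} (hg : σ g ≤ c) (x : X) :
    pdist σ x (g • x) ≤ c := by
  refine (pdist_le_iff σ c _ _).2 fun ε hε A _ hxA => subset_closure ⟨g, ?_, x, hxA, rfl⟩
  show σ g < c + ε
  linarith

theorem mem_closure_of_pdist_lt {σ : GroupSeminorm G} {c : ℝ≥0} {x y : X} (h : pdist σ x y < c)
    {A : Set X} (hA : IsOpen A) (hx : x ∈ A) : y ∈ closure (snBall σ c • A) := by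
  obtain ⟨d, hd, hdc⟩ := ENNReal.lt_iff_exists_nnreal_btwn.1 h
  have hdc' : (d : ℝ) < c := by exact_mod_cast hdc
  have := (pdist_le_iff σ d x y).1 hd.le (c - d) (by linarith) A hA hx
  simpa using this

variable [ContinuousConstSMul G X] [TopologicalSpace G]

/-- Near a compatible point, a `G`-ED flow is topologically transitive up to small balls. -/
theorem exists_isUTT_of_isCompatiblePoint (hX : IsGED G X) {σ : GroupSeminorm G}
    (hσ : σ ∈ SN G) {x : X} (hx : IsCompatiblePoint (pdist σ) x) {c : ℝ} (hc : 0 < c) {A : Set X}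
    (hA : IsOpen A) (hxA : x ∈ A) : ∃ A₀ ⊆ A, x ∈ A₀ ∧ IsUTT (snBall σ c) A₀ := by
  lift c to ℝ≥0 using hc.le
  have hc' : (0 : ℝ≥0∞) < ((c / 2 : ℝ≥0) : ℝ≥0∞) := by
    rw [ENNReal.coe_pos]; exact half_pos (by exact_mod_cast hc)
  refine ⟨A ∩ interior {z | pdist σ x z < ((c / 2 : ℝ≥0) : ℝ≥0∞)}, inter_subset_left,
    ⟨hxA, hx _ hc'⟩, hA.inter isOpen_interior, ⟨x, hxA, hx _ hc'⟩, fun B hBA hB ⟨b, hb⟩ a ha => ?_⟩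
  have hlt : ∀ z ∈ interior {z | pdist σ x z < ((c / 2 : ℝ≥0) : ℝ≥0∞)},
      pdist σ x z < ((c / 2 : ℝ≥0) : ℝ≥0∞) := fun z hz =>
    interior_subset (s := {z | pdist σ x z < ((c / 2 : ℝ≥0) : ℝ≥0∞)}) hz
  have h1 := hlt b (hBA hb).2
  have h2 := hlt a ha.2
  refine mem_closure_of_pdist_lt ?_ hB hb
  calc pdist σ b a ≤ pdist σ b x + pdist σ x a := pdist_triangle hX hσ _ _ _
    _ < ((c / 2 : ℝ≥0) : ℝ≥0∞) + ((c / 2 : ℝ≥0) : ℝ≥0∞) :=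
      ENNReal.add_lt_add (by rwa [pdist_symm]) h2
    _ = c := by rw [← ENNReal.coe_add, add_halves]

theorem somewhereUTT_of_isSNBase (hX : IsGED G X) {B : Set (GroupSeminorm G)} (hB : IsSNBase B)
    (h : ∀ σ ∈ B, ∃ x : X, IsCompatiblePoint (pdist σ) x) :
    ∀ U ∈ 𝓝 (1 : G), SomewhereUTT U (univ : Set X) := by
  intro U hU
  obtain ⟨⟨σ, ε⟩, ⟨hσ, hε⟩, hσU⟩ := hB.2.mem_iff.1 hU
  obtain ⟨x, hx⟩ := h σ hσ
  obtain ⟨A₀, hA₀, -, hA₀'⟩ :=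
    exists_isUTT_of_isCompatiblePoint hX (hB.1 hσ) hx hε isOpen_univ (mem_univ x)
  exact ⟨A₀, hA₀, hA₀'.mono hσU⟩

omit [ContinuousConstSMul G X] in
theorem dense_isCompatiblePoint_of_rosendalCriterion [BaireSpace X] (h : RosendalCriterion G X)
    {σ : GroupSeminorm G} (hσ : σ ∈ SN G) : Dense {x : X | IsCompatiblePoint (pdist σ) x} := by
  let O : ℕ → Set X := fun n => ⋃₀ {A | IsUTT (snBall σ ((1 / (n + 1) : ℝ≥0) : ℝ)) A}
  have hO : ∀ n, IsOpen (O n) := fun n => isOpen_sUnion fun A hA => hA.1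
  have hOd : ∀ n, Dense (O n) := fun n => dense_iff_inter_open.2 fun A hA hAn => by
    have hpos : (0 : ℝ) < ((1 / (n + 1) : ℝ≥0) : ℝ) := by positivity
    obtain ⟨B, hBA, hB⟩ := h _ (snBall_mem_nhds_one hσ hpos) A hA hAn
    obtain ⟨b, hb⟩ := hB.2.1
    exact ⟨b, hBA hb, B, hB, hb⟩
  -- A point of every `O n` lies in open sets of arbitrarily small `∂_σ`-diameter.
  refine (dense_iInter_of_isOpen_nat hO hOd).mono fun x hx c hc => ?_
  obtain ⟨d, hd0, hdc⟩ := ENNReal.lt_iff_exists_nnreal_btwn.1 hc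
  obtain ⟨n, hn⟩ := exists_nat_one_div_lt (show (0 : ℝ) < d by exact_mod_cast hd0)
  obtain ⟨A, hA, hxA⟩ := mem_iInter.1 hx n
  refine interior_maximal (fun y hy => (IsUTT.pdist_le hA hxA hy).trans_lt (lt_of_le_of_lt ?_ hdc))
    hA.1 hxA
  have : ((1 / (n + 1) : ℝ≥0) : ℝ) ≤ d := by push_cast; exact hn.le
  exact_mod_cast this

end Compatibility

/-! ### Compatible points of the quotient by `∂_σ`. -/

section Quotient

variable {G : Type u} [Group G] {X : Type v} [TopologicalSpace X] [MulAction G X]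
  [ContinuousConstSMul G X]

/-- The union of the closures of `B_σ(c) A` over `c < r`. -/
def pdistHull (σ : GroupSeminorm G) (A : Set X) (r : ℝ) : Set X :=
  {y | ∃ c, 0 < c ∧ c < r ∧ y ∈ closure (snBall σ c • A)}

omit [ContinuousConstSMul G X] in
theorem subset_pdistHull (σ : GroupSeminorm G) (A : Set X) {r : ℝ} (hr : 0 < r) :
    A ⊆ pdistHull σ A r := fun a ha =>
  ⟨r / 2, by linarith, by linarith, subset_closure ⟨1, by simpa [snBall] using hr, a, ha, by simp⟩⟩

variable [TopologicalSpace G]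

theorem closure_snBall_smul_subset_interior (hX : IsGED G X) {σ : GroupSeminorm G} (hσ : σ ∈ SN G)
    {A : Set X} (hA : IsOpen A) {c d : ℝ} (hd : 0 < d) :
    closure (snBall σ c • A) ⊆ interior (closure (snBall σ (d + c) • A)) := by
  refine (hX σ hσ d hd _ hA.smul_left).trans (interior_mono (closure_minimal ?_ isClosed_closure))
  exact (smul_subset_smul_left subset_closure).trans (snBall_smul_closure σ _ _ A)

/-- The strict bound `c < r` leaves room to enlarge the radius, and by `G`-ED an enlarged closure is
a neighbourhood of the original one. -/
theorem isOpen_pdistHull (hX : IsGED G X) {σ : GroupSeminorm G} (hσ : σ ∈ SN G)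
    {A : Set X} (hA : IsOpen A) (r : ℝ) : IsOpen (pdistHull σ A r) := by
  refine isOpen_iff_mem_nhds.2 fun y ⟨c, hc0, hcr, hy⟩ => ?_
  have h1 := closure_snBall_smul_subset_interior hX hσ hA (half_pos (sub_pos.2 hcr)) hy
  exact mem_of_superset (mem_interior_iff_mem_nhds.1 h1) fun z hz =>
    ⟨_, by linarith, by linarith, hz⟩

theorem mem_pdistHull_of_pdist_eq_zero (hX : IsGED G X) {σ : GroupSeminorm G} (hσ : σ ∈ SN G)
    {A : Set X} (hA : IsOpen A) {r : ℝ} {y z : X} (hy : y ∈ pdistHull σ A r)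
    (hyz : pdist σ y z = 0) : z ∈ pdistHull σ A r := by
  obtain ⟨c, hc0, hcr, hy⟩ := hy
  -- One third opens up the closure, one third approximates `∂_σ(y, z) = 0`, and the last keeps the
  -- radius below `r`.
  have hd : 0 < (r - c) / 3 := by linarith
  have h1 := closure_snBall_smul_subset_interior hX hσ hA hd hy
  have h2 := (pdist_le_iff σ 0 y z).1 hyz.le _ hd _ isOpen_interior h1
  refine ⟨(r - c) / 3 + ((r - c) / 3 + c), by linarith, by linarith, ?_⟩
  refine closure_minimal ?_ isClosed_closure h2
  rw [NNReal.coe_zero, zero_add]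
  exact (smul_subset_smul_left interior_subset).trans (snBall_smul_closure σ _ _ A)

theorem isOpen_image_mk_pdistHull (hX : IsGED G X) {σ : GroupSeminorm G} (hσ : σ ∈ SN G)
    {A : Set X} (hA : IsOpen A) (r : ℝ) :
    IsOpen ((fun x => (Quotient.mk _ x : PdistQuotient hX hσ)) '' pdistHull σ A r) := by
  refine isOpen_coinduced.2 ?_
  convert isOpen_pdistHull hX hσ hA r using 1
  refine Subset.antisymm ?_ fun y hy => ⟨y, hy, rfl⟩
  rintro y ⟨x, hx, hxy⟩
  exact mem_pdistHull_of_pdist_eq_zero hX hσ hA hx (Quotient.exact hxy)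

theorem isCompatiblePoint_of_mk (hX : IsGED G X) {σ : GroupSeminorm G} (hσ : σ ∈ SN G) {x : X}
    (h : IsCompatiblePoint (quotientPdist hX hσ) (Quotient.mk _ x)) :
    IsCompatiblePoint (pdist σ) x := fun c hc =>
  preimage_interior_subset_interior_preimage (f := fun x => (Quotient.mk _ x : PdistQuotient hX hσ))
    continuous_quotient_mk' (h c hc)

/-- The hull of radius `d / 2` around the interior of a `d / 2`-ball is open and saturated, and
stays within the closed ball of radius `d < c`. -/
theorem isCompatiblePoint_mk (hX : IsGED G X) {σ : GroupSeminorm G} (hσ : σ ∈ SN G) {x : X}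
    (h : IsCompatiblePoint (pdist σ) x) :
    IsCompatiblePoint (quotientPdist hX hσ) (Quotient.mk _ x) := by
  intro c hc
  obtain ⟨d, hd0, hdc⟩ := ENNReal.lt_iff_exists_nnreal_btwn.1 hc
  have hd : 0 < d := by exact_mod_cast hd0
  have hd2 : (0 : ℝ≥0∞) < ((d / 2 : ℝ≥0) : ℝ≥0∞) := by
    rw [ENNReal.coe_pos]; exact half_pos hd
  refine interior_maximal ?_ (isOpen_image_mk_pdistHull hX hσ
    (isOpen_interior (s := {z | pdist σ x z < ((d / 2 : ℝ≥0) : ℝ≥0∞)})) (d / 2 : ℝ≥0))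
    ⟨x, subset_pdistHull σ _ (by exact_mod_cast half_pos hd) (h _ hd2), rfl⟩
  rintro _ ⟨z, ⟨e, -, he, hz⟩, rfl⟩
  refine lt_of_le_of_lt ?_ hdc
  refine closure_minimal ?_ (isClosed_setOf_pdist_le σ d x) hz
  rintro _ ⟨g, hg, a, ha, rfl⟩
  have hg' : σ g < e := hg
  calc pdist σ x (g • a) ≤ pdist σ x a + pdist σ a (g • a) := pdist_triangle hX hσ _ _ _
    _ ≤ ((d / 2 : ℝ≥0) : ℝ≥0∞) + ((d / 2 : ℝ≥0) : ℝ≥0∞) :=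
      add_le_add (interior_subset ha).le (pdist_smul_le σ (hg'.trans he).le a)
    _ = d := by rw [← ENNReal.coe_add, add_halves]

theorem dense_isCompatiblePoint_quotient (hX : IsGED G X) {σ : GroupSeminorm G} (hσ : σ ∈ SN G)
    (h : Dense {x : X | IsCompatiblePoint (pdist σ) x}) :
    Dense {x : PdistQuotient hX hσ | IsCompatiblePoint (quotientPdist hX hσ) x} := by
  refine ((Quotient.mk_surjective).denseRange.dense_image continuous_quotient_mk' h).mono ?_
  rintro _ ⟨x, hx, rfl⟩
  exact isCompatiblePoint_mk hX hσ hx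

theorem rosendalCriterion_of_dense_quotient [IsTopologicalGroup G] (hX : IsGED G X)
    (h : ∀ (σ : GroupSeminorm G) (hσ : σ ∈ SN G),
      Dense {x : PdistQuotient hX hσ | IsCompatiblePoint (quotientPdist hX hσ) x}) :
    RosendalCriterion G X := by
  intro U hU A hA hAn
  obtain ⟨σ, hσ, ε, hε, hU⟩ := exists_snBall_subset hU
  have hε4 : 0 < ε / 4 := by linarith
  obtain ⟨_, ⟨x, ⟨c, hc0, hcε, hxA⟩, rfl⟩, hx⟩ := (h σ hσ).inter_open_nonempty _
    (isOpen_image_mk_pdistHull hX hσ hA (ε / 4)) ((hAn.mono (subset_pdistHull σ A hε4)).image _)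
  obtain ⟨A₁, -, hxA₁, hA₁⟩ := exists_isUTT_of_isCompatiblePoint hX hσ
    (isCompatiblePoint_of_mk hX hσ hx) hε4 isOpen_univ (mem_univ x)
  obtain ⟨z, hz, g, hg, a, ha, hgz⟩ := mem_closure_iff.1 hxA A₁ hA₁.1 hxA₁
  have hgc : σ g < c := hg
  -- The compatible point lies only in the hull of `A`, so `A₁` must be moved back by `g`.
  -- Conjugation costs `2 σ(g)`, for a total below `3ε/4`.
  have h1 : IsUTT U (g⁻¹ • A₁) := hA₁.smul g⁻¹ fun u hu => hU <| by
    have hu' : σ u < ε / 4 := hu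
    have e1 := map_mul_le_add σ (g⁻¹ * u) g⁻¹⁻¹
    have e2 := map_mul_le_add σ g⁻¹ u
    rw [map_inv_eq_map] at e1 e2
    rw [map_inv_eq_map] at e1
    show σ _ < ε
    linarith
  refine ⟨g⁻¹ • A₁ ∩ A, inter_subset_right, h1.subset inter_subset_left (h1.1.inter hA) ?_⟩
  exact ⟨a, mem_smul_set_iff_inv_smul_mem.2 (by simpa [← hgz] using hz), ha⟩

end Quotient

/-! ### The Gleason completion as a compact Hausdorff space. -/

section NearUltrafilters

variable {G : Type u} [Group G] [TopologicalSpace G]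
variable {Z : Type v} [TopologicalSpace Z] [MulAction G Z]

theorem NearFIP.exists_gleasonCompletion {p : Set (Set Z)} (hp : NearFIP G p) :
    ∃ q : GleasonCompletion G Z, p ⊆ q.carrier := by
  obtain ⟨q, hpq, hq⟩ := zorn_subset_nonempty {q | NearFIP G q} (fun c hc hch hcn => by
    refine ⟨⋃₀ c, ⟨fun A ⟨q, hq, hA⟩ => (hc hq).1 A hA, fun F hF hFf U hU => ?_⟩,
      fun q hq => subset_sUnion_of_mem hq⟩
    obtain ⟨q, hq, hFq⟩ := DirectedOn.exists_mem_subset_of_finite_of_subset_sUnion hcn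
      hch.directedOn hFf hF
    exact (hc hq).2 F hFq hFf U hU) p hp
  exact ⟨⟨q, hq⟩, hpq⟩

namespace GleasonCompletion

theorem nonempty_inter (p : GleasonCompletion G Z) {A B : Set Z} (hA : A ∈ p) (hB : B ∈ p)
    {U : Set G} (hU : U ∈ 𝓝 (1 : G)) : ((U • A) ∩ (U • B)).Nonempty := by
  obtain ⟨z, hz⟩ := p.maximal.1.2 {A, B} (by rintro _ (rfl | rfl) <;> assumption) (by simp) U hU
  simp only [mem_iInter] at hz
  exact ⟨z, hz A (by simp), hz B (by simp)⟩

theorem isOpen_of_mem (p : GleasonCompletion G Z) {A : Set Z} (hA : A ∈ p) : IsOpen A :=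
  p.maximal.1.1 A hA

theorem nonempty_of_mem (p : GleasonCompletion G Z) {A : Set Z} (hA : A ∈ p) : A.Nonempty := by
  obtain ⟨z, ⟨g, -, a, ha, -⟩, -⟩ := p.nonempty_inter hA hA (U := univ) Filter.univ_mem
  exact ⟨a, ha⟩

theorem mem_of_forall_smul_subset (p : GleasonCompletion G Z) {A B : Set Z} (hA : A ∈ p)
    (hB : IsOpen B) (h : ∀ U ∈ 𝓝 (1 : G), ∃ V ∈ 𝓝 (1 : G), V • A ⊆ U • B) : B ∈ p := by
  by_contra hBp
  obtain ⟨F, hF, hFf, U, hU, hFU⟩ := p.exists_of_not_mem hB hBp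
  obtain ⟨V, hV, hVU⟩ := h U hU
  obtain ⟨z, hz⟩ := p.maximal.1.2 (insert A F) (insert_subset hA hF) (hFf.insert _) (U ∩ V)
    (inter_mem hU hV)
  simp only [mem_iInter] at hz
  refine (eq_empty_iff_forall_notMem.1 hFU) z ⟨?_, hVU
    (smul_subset_smul_right inter_subset_right (hz A (mem_insert _ _)))⟩
  simp only [mem_iInter]
  exact fun C hC => smul_subset_smul_right inter_subset_left (hz C (mem_insert_of_mem _ hC))

theorem mem_of_superset (p : GleasonCompletion G Z) {A B : Set Z} (hA : A ∈ p)
    (hB : IsOpen B) (h : A ⊆ B) : B ∈ p :=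
  p.mem_of_forall_smul_subset hA hB fun U hU => ⟨U, hU, smul_subset_smul_left h⟩

/-- A finite intersection of fattened members is open, so a common point with `U A` can be perturbed
into `U B`. -/
theorem mem_of_subset_closure [ContinuousConstSMul G Z] (p : GleasonCompletion G Z) {A B : Set Z}
    (hA : A ∈ p) (hB : IsOpen B) (h : A ⊆ closure B) : B ∈ p := by
  by_contra hBp
  obtain ⟨F, hF, hFf, U, hU, hFU⟩ := p.exists_of_not_mem hB hBp
  obtain ⟨z, hz⟩ := p.maximal.1.2 (insert A F) (insert_subset hA hF) (hFf.insert _) U hU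
  have hz' : z ∈ (⋂ C ∈ F, U • C) ∩ U • A := by
    simp only [mem_iInter, mem_inter_iff] at hz ⊢
    exact ⟨fun C hC => hz C (mem_insert_of_mem _ hC), hz A (mem_insert _ _)⟩
  have ho : IsOpen (⋂ C ∈ F, U • C) :=
    hFf.isOpen_biInter fun C hC => (p.isOpen_of_mem (hF hC)).smul_left
  obtain ⟨g, hg, a, ha, rfl⟩ := hz'.2
  obtain ⟨b, hb, hbB⟩ := mem_closure_iff.1 (h ha) _ (ho.preimage (continuous_const_smul g)) hz'.1
  exact (eq_empty_iff_forall_notMem.1 hFU) _ ⟨hb, g, hg, b, hbB, rfl⟩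

theorem isOpen_setOf_not_mem {A : Set Z} (hA : IsOpen A) :
    IsOpen {p : GleasonCompletion G Z | A ∉ p} :=
  TopologicalSpace.isOpen_generateFrom_of_mem ⟨A, hA, rfl⟩

theorem isClosed_setOf_mem {A : Set Z} (hA : IsOpen A) :
    IsClosed {p : GleasonCompletion G Z | A ∈ p} := by
  have := (isOpen_setOf_not_mem (G := G) hA).isClosed_compl
  convert this using 1
  ext p
  simp

theorem isTopologicalBasis : TopologicalSpace.IsTopologicalBasis
    {N : Set (GleasonCompletion G Z) | ∃ A : Set Z, IsOpen A ∧ N = {p | A ∉ p}} := by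
  refine ⟨?_, ?_, rfl⟩
  · rintro _ ⟨A, hA, rfl⟩ _ ⟨B, hB, rfl⟩ p ⟨hpA, hpB⟩
    refine ⟨_, ⟨A ∪ B, hA.union hB, rfl⟩, fun h => ?_, fun q hq => ⟨fun h => ?_, fun h => ?_⟩⟩
    · exact (p.mem_or_mem_of_union_mem hA hB h).elim hpA hpB
    · exact hq (q.mem_of_superset h (hA.union hB) subset_union_left)
    · exact hq (q.mem_of_superset h (hA.union hB) subset_union_right)
  · refine eq_univ_of_forall fun p => ⟨_, ⟨∅, isOpen_empty, rfl⟩, fun h => ?_⟩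
    exact not_nonempty_empty (p.nonempty_of_mem h)

/-- If a cover by basic sets has no finite subcover, the sets `A` defining it have finite near
intersections; a near ultrafilter containing them all is uncovered. -/
instance : CompactSpace (GleasonCompletion G Z) := by
  refine ⟨isCompact_generateFrom rfl fun P hP hcov => ?_⟩
  by_contra! hcon
  have hfip : NearFIP G {A : Set Z | IsOpen A ∧ {p : GleasonCompletion G Z | A ∉ p} ∈ P} := by
    refine ⟨fun A hA => hA.1, fun F hF hFf U hU => ?_⟩
    have hQ := hcon ((fun A : Set Z => {p : GleasonCompletion G Z | A ∉ p}) '' F)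
      (image_subset_iff.2 fun A hA => (hF hA).2) (hFf.image _)
    obtain ⟨p, -, hp⟩ := not_subset.1 hQ
    refine p.maximal.1.2 F (fun A hA => ?_) hFf U hU
    by_contra hAp
    exact hp ⟨_, ⟨A, hA, rfl⟩, hAp⟩
  obtain ⟨q, hq⟩ := hfip.exists_gleasonCompletion
  obtain ⟨N, hN, hqN⟩ := hcov (mem_univ q)
  obtain ⟨A, hA, rfl⟩ := hP hN
  exact hqN (hq ⟨hA, hN⟩)

variable [IsTopologicalGroup G]

/-- Every `p` omitting `A` omits some fattening `V A`. -/
theorem exists_smul_not_mem (p : GleasonCompletion G Z) {A : Set Z} (hA : IsOpen A) (h : A ∉ p) :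
    ∃ V ∈ 𝓝 (1 : G), V⁻¹ = V ∧ V • A ∉ p := by
  obtain ⟨F, hF, hFf, U, hU, hFU⟩ := p.exists_of_not_mem hA h
  obtain ⟨V, hV, -, hVi, hVU⟩ := exists_closed_nhds_one_inv_eq_mul_subset hU
  refine ⟨V, hV, hVi, fun hVA => ?_⟩
  obtain ⟨z, hz⟩ := p.maximal.1.2 (insert (V • A) F) (insert_subset hVA hF) (hFf.insert _) (U ∩ V)
    (inter_mem hU hV)
  simp only [mem_iInter] at hz
  refine (eq_empty_iff_forall_notMem.1 hFU) z ⟨?_, ?_⟩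
  · simp only [mem_iInter]
    exact fun C hC => smul_subset_smul_right inter_subset_left (hz C (mem_insert_of_mem _ hC))
  · refine smul_subset_smul_right hVU ?_
    rw [← smul_smul]
    exact smul_subset_smul_right inter_subset_right (hz _ (mem_insert _ _))

theorem compl_closure_smul_not_mem (p : GleasonCompletion G Z) {A : Set Z} (hA : A ∈ p) {V : Set G}
    (hV : V ∈ 𝓝 (1 : G)) : (closure (V • A))ᶜ ∉ p := by
  intro h
  obtain ⟨W, hW, -, hWi, hWV⟩ := exists_closed_nhds_one_inv_eq_mul_subset hV
  obtain ⟨z, ⟨g, hg, a, ha, hz⟩, ⟨k, hk, b, hb, hz'⟩⟩ := p.nonempty_inter hA h hW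
  refine hb (subset_closure ⟨k⁻¹ * g, hWV ⟨k⁻¹, by rwa [← hWi, Set.inv_mem_inv], g, hg, rfl⟩,
    a, ha, ?_⟩)
  simp only at hz hz' ⊢
  rw [mul_smul, hz, ← hz', inv_smul_smul]

variable [ContinuousConstSMul G Z]

/-- Take `A` in `p` but not in `q`, and `V` with `V A ∉ q`. The union of `V A` and the complement of
its closure is dense, so no near ultrafilter omits both. -/
instance : T2Space (GleasonCompletion G Z) := by
  have key : ∀ p q : GleasonCompletion G Z, p ≠ q → ∃ A ∈ p, A ∉ q := by
    intro p q hpq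
    by_contra! h
    exact hpq (GleasonCompletion.ext (p.maximal.eq_of_le q.maximal.1 h))
  refine ⟨fun p q hpq => ?_⟩
  obtain ⟨A, hAp, hAq⟩ := key p q hpq
  have hA := p.isOpen_of_mem hAp
  obtain ⟨V, hV, -, hVq⟩ := q.exists_smul_not_mem hA hAq
  refine ⟨_, _, isOpen_setOf_not_mem isClosed_closure.isOpen_compl,
    isOpen_setOf_not_mem hA.smul_left, p.compl_closure_smul_not_mem hAp hV, hVq,
    disjoint_left.2 fun r h1 h2 => ?_⟩
  have hcl : IsOpen (closure (V • A))ᶜ := isClosed_closure.isOpen_compl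
  refine (r.mem_or_mem_of_union_mem hcl hA.smul_left (r.mem_of_subset_closure r.univ_mem
    (hcl.union hA.smul_left) fun z _ => ?_)).elim h1 h2
  rw [closure_union]
  by_cases hz : z ∈ closure (V • A)
  · exact .inr hz
  · exact .inl (subset_closure hz)

instance : ContinuousConstSMul G (GleasonCompletion G Z) where
  continuous_const_smul g := by
    refine continuous_generateFrom_iff.2 ?_
    rintro _ ⟨A, hA, rfl⟩
    exact isOpen_setOf_not_mem (hA.preimage (continuous_const_smul g))

end GleasonCompletion

end NearUltrafilters

/-! ### Minimal subflows and highly proximal maps. -/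

section Subflows

variable {G : Type u} [Group G] {Y : Type v} [TopologicalSpace Y] [MulAction G Y] [T2Space Y]

theorem IsSubflow.exists_isMinimalSubflow {M : Set Y} (hM : IsSubflow G M) :
    ∃ N ⊆ M, IsMinimalSubflow G N := by
  obtain ⟨N, hNM, hN⟩ := zorn_superset_nonempty {N : Set Y | IsSubflow G N} (fun c hc hch hcn => by
    refine ⟨⋂₀ c, ⟨?_, ?_, ?_⟩, fun s hs => sInter_subset_of_mem hs⟩
    · have : Nonempty c := hcn.to_subtype
      rw [sInter_eq_iInter]
      refine IsCompact.nonempty_iInter_of_directed_nonempty_isCompact_isClosed _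
        (fun a b => ?_) (fun a => (hc a.2).1) (fun a => (hc a.2).2.1)
        fun a => (hc a.2).2.1.isClosed
      rcases hch.total a.2 b.2 with h | h
      · exact ⟨a, Subset.rfl, h⟩
      · exact ⟨b, h, Subset.rfl⟩
    · obtain ⟨K, hK⟩ := hcn
      exact (hc hK).2.1.of_isClosed_subset
        (isClosed_sInter fun s hs => (hc hs).2.1.isClosed) (sInter_subset_of_mem hK)
    · exact fun g y hy s hs => (hc hs).2.2 g y (hy s hs)) M hM
  exact ⟨N, hNM, hN⟩

theorem IsMinimalSubflow.eq_of_nonempty_inter {M N : Set Y} (hM : IsMinimalSubflow G M)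
    (hN : IsMinimalSubflow G N) (h : (M ∩ N).Nonempty) : M = N := by
  have hMN : IsSubflow G (M ∩ N) := ⟨h, hM.1.2.1.inter_right hN.1.2.1.isClosed,
    fun g y hy => ⟨hM.1.2.2 g y hy.1, hN.1.2.2 g y hy.2⟩⟩
  exact Subset.antisymm ((hM.2 hMN inter_subset_left).trans inter_subset_right)
    ((hN.2 hMN inter_subset_right).trans inter_subset_left)

/-- Above a minimal flow, the total space of a highly proximal map has only one minimal subflow. -/
theorem IsHighlyProximal.existsUnique_isMinimalSubflow [CompactSpace Y] {X : Type w}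
    [TopologicalSpace X] [T2Space X] [Nonempty X] [MulAction G X] [MulAction.IsMinimal G X]
    {π : Y → X} (hπ : IsHighlyProximal G π) : ∃! M : Set Y, IsMinimalSubflow G M := by
  obtain ⟨hc, he, hs, hf⟩ := hπ
  have hsurj : ∀ M : Set Y, IsSubflow G M → π '' M = univ := by
    intro M hM
    have hcl : IsClosed (π '' M) := (hM.2.1.image hc).isClosed
    obtain ⟨m, hm⟩ := hM.1
    refine eq_univ_of_univ_subset ?_
    rw [← (MulAction.dense_orbit G (π m)).closure_eq]
    refine closure_minimal ?_ hcl
    rintro _ ⟨g, rfl⟩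
    exact ⟨g • m, hM.2.2 g m hm, he g m⟩
  obtain ⟨x⟩ := ‹Nonempty X›
  obtain ⟨l, hl, y, hy⟩ := hf x
  have hmem : ∀ M : Set Y, IsSubflow G M → y ∈ M := by
    intro M hM
    -- If `y ∉ M`, some translate of the fibre would miss `M`, but the fibre meets the invariant set
    -- `M`.
    by_contra hyM
    have ho : IsOpen Mᶜ := hM.2.1.isClosed.isOpen_compl
    obtain ⟨m, hm, hmx⟩ : x ∈ π '' M := hsurj M hM ▸ mem_univ x
    have hev : ∀ᶠ g in l, g • (π ⁻¹' {x}) ∈ Mᶜ.powerset := by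
      let := TopologicalSpace.vietoris Y
      exact hy.eventually_mem (ho.powerset_vietoris.mem_nhds (singleton_subset_iff.2 hyM))
    obtain ⟨g, hg⟩ := hev.exists
    exact hg (smul_mem_smul_set (show m ∈ π ⁻¹' {x} from hmx)) (hM.2.2 g m hm)
  obtain ⟨y₀, -⟩ := hs x
  have huniv : IsSubflow G (univ : Set Y) := ⟨⟨y₀, trivial⟩, isCompact_univ, fun _ _ _ => trivial⟩
  obtain ⟨M, -, hM⟩ := huniv.exists_isMinimalSubflow
  exact ⟨M, hM, fun N hN => hN.eq_of_nonempty_inter hM ⟨y, hmem N hN.1, hmem M hM.1⟩⟩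

end Subflows

/-! ### Ultracopowers and their maps to `X`. -/

section Ultracopower

variable {G : Type u} [Group G] [TopologicalSpace G]
variable {I : Type w} {X : Type v} [TopologicalSpace X] [MulAction G X]

namespace Ultracopower

theorem continuous_snd : Continuous (Sigma.snd : (Σ _ : I, X) → X) :=
  continuous_sigma fun _ => continuous_id

theorem isOpen_preimage_fst (S : Set I) : IsOpen (Sigma.fst ⁻¹' S : Set (Σ _ : I, X)) :=
  isOpen_sigma_iff.2 fun i => by
    by_cases hi : i ∈ S
    · convert isOpen_univ using 1
      exact eq_univ_of_forall fun _ => hi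
    · convert isOpen_empty using 1
      exact eq_empty_of_forall_notMem fun _ h => hi h

variable {𝒰 : Ultrafilter I}

theorem continuous_val :
    Continuous (Subtype.val : Ultracopower G X 𝒰 → GleasonCompletion G (Σ _ : I, X)) :=
  continuous_subtype_val

theorem isClosed_setOf :
    IsClosed {p : GleasonCompletion G (Σ _ : I, X) | ∀ S ∈ 𝒰, Sigma.fst ⁻¹' S ∈ p} := by
  simp only [ofPred_forall]
  exact isClosed_biInter fun S _ => GleasonCompletion.isClosed_setOf_mem (isOpen_preimage_fst S)

instance : CompactSpace (Ultracopower G X 𝒰) :=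
  isCompact_iff_compactSpace.1 (isClosed_setOf (G := G) (X := X) (𝒰 := 𝒰)).isCompact

theorem exists_basic_nhds {y : Ultracopower G X 𝒰} {O : Set (Ultracopower G X 𝒰)} (hO : IsOpen O)
    (hy : y ∈ O) : ∃ A : Set (Σ _ : I, X), IsOpen A ∧ A ∉ y.1 ∧
      ∀ p : Ultracopower G X 𝒰, A ∉ p.1 → p ∈ O := by
  obtain ⟨O', hO', rfl⟩ := isOpen_induced_iff.1 hO
  obtain ⟨_, ⟨A, hA, rfl⟩, hyA, hAO⟩ :=
    GleasonCompletion.isTopologicalBasis.exists_subset_of_mem_open hy hO'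
  exact ⟨A, hA, hyA, fun p hp => hAO hp⟩

/-- A family of open sets with the finite intersection property along `𝒰` extends to a point of the
ultracopower. -/
theorem exists_of_finite_inter {P : Set (Set (Σ _ : I, X))} (hP : ∀ A ∈ P, IsOpen A)
    (h : ∀ F ⊆ P, F.Finite → ∀ S ∈ 𝒰, ∃ z : Σ _ : I, X, z.1 ∈ S ∧ ∀ A ∈ F, z ∈ A) :
    ∃ p : Ultracopower G X 𝒰, ∀ A ∈ P, A ∈ p.1 := by
  have hfip : NearFIP G (P ∪ {A | ∃ S ∈ 𝒰, A = Sigma.fst ⁻¹' S}) := by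
    refine ⟨?_, fun F hF hFf U hU => ?_⟩
    · rintro A (hA | ⟨S, -, rfl⟩)
      · exact hP A hA
      · exact isOpen_preimage_fst S
    · have hS : (⋂ A ∈ F \ P, {i : I | ∀ x : X, (⟨i, x⟩ : Σ _ : I, X) ∈ A}) ∈ 𝒰 := by
        refine (biInter_mem (hFf.subset sdiff_subset)).2 fun A hA => ?_
        obtain ⟨S, hS, rfl⟩ := (hF hA.1).resolve_left hA.2
        exact Filter.mem_of_superset hS fun i hi x => hi
      obtain ⟨z, hzS, hz⟩ := h (F ∩ P) inter_subset_right (hFf.subset inter_subset_left) _ hS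
      refine ⟨z, mem_iInter₂.2 fun A hA => ⟨1, mem_of_mem_nhds hU, z, ?_, one_smul _ _⟩⟩
      by_cases hAP : A ∈ P
      · exact hz A ⟨hA, hAP⟩
      · exact mem_iInter₂.1 hzS A ⟨hA, hAP⟩ z.2
  obtain ⟨q, hq⟩ := hfip.exists_gleasonCompletion
  exact ⟨⟨q, fun S hS => hq (.inr ⟨S, hS, rfl⟩)⟩, fun A hA => hq (.inl hA)⟩

/-- `S × X` and its complement are disjoint and invariant, so their fattenings stay disjoint and no
near ultrafilter contains a subset of each. -/
theorem inter_preimage_fst_mem (p : Ultracopower G X 𝒰) {C : Set (Σ _ : I, X)} (hC : C ∈ p.1)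
    {S : Set I} (hS : S ∈ 𝒰) : C ∩ Sigma.fst ⁻¹' S ∈ p.1 := by
  have hCo := p.1.isOpen_of_mem hC
  have h1 := hCo.inter (isOpen_preimage_fst (X := X) S)
  have h2 := hCo.inter (isOpen_preimage_fst (X := X) Sᶜ)
  refine (p.1.mem_or_mem_of_union_mem h1 h2 (p.1.mem_of_superset hC (h1.union h2) fun z hz => ?_)
    ).resolve_right fun h => ?_
  · by_cases hzS : z.1 ∈ S
    · exact .inl ⟨hz, hzS⟩
    · exact .inr ⟨hz, hzS⟩
  · obtain ⟨z, ⟨g, -, a, ha, haz⟩, ⟨k, -, b, hb, hbz⟩⟩ :=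
      p.1.nonempty_inter (p.2 S hS) h (U := univ) Filter.univ_mem
    have e1 : (g • a).1 = z.1 := congrArg Sigma.fst haz
    have e2 : (k • b).1 = z.1 := congrArg Sigma.fst hbz
    exact hb.2 (show (k • b).1 ∈ S by rw [e2, ← e1]; exact ha)

variable [IsTopologicalGroup G]

instance [ContinuousConstSMul G X] : T2Space (Ultracopower G X 𝒰) :=
  inferInstanceAs (T2Space {p : GleasonCompletion G (Σ _ : I, X) // ∀ S ∈ 𝒰, Sigma.fst ⁻¹' S ∈ p})

variable [CompactSpace X] [T2Space X] [ContinuousSMul G X]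

omit [IsTopologicalGroup G] in
theorem preimage_snd_mem (p : Ultracopower G X 𝒰) {A : Set X} (hA : IsOpen A)
    (h : ultracopowerMap 𝒰 p ∈ A) : Sigma.snd ⁻¹' A ∈ p.1 :=
  (existsUnique_proj p.1).choose_spec.1 A hA h

omit [IsTopologicalGroup G] in
theorem ultracopowerMap_eq (p : Ultracopower G X 𝒰) {x : X}
    (h : ∀ A : Set X, IsOpen A → x ∈ A → Sigma.snd ⁻¹' A ∈ p.1) : ultracopowerMap 𝒰 p = x :=
  ((existsUnique_proj p.1).choose_spec.2 x h).symm

theorem ultracopowerMap_smul (g : G) (p : Ultracopower G X 𝒰) :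
    ultracopowerMap 𝒰 (g • p) = g • ultracopowerMap 𝒰 p :=
  ultracopowerMap_eq _ fun _ hA hx =>
    preimage_snd_mem p (hA.preimage (continuous_const_smul g)) hx

omit [IsTopologicalGroup G] in
theorem ultracopowerMap_surjective :
    Function.Surjective (ultracopowerMap (G := G) (X := X) 𝒰) := by
  intro x
  obtain ⟨p, hp⟩ := exists_of_finite_inter (G := G) (𝒰 := 𝒰)
    (P := {C : Set (Σ _ : I, X) | ∃ A : Set X, IsOpen A ∧ x ∈ A ∧ C = Sigma.snd ⁻¹' A})
    (by rintro _ ⟨A, hA, -, rfl⟩; exact hA.preimage continuous_snd) (fun F hF _ S hS => by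
      obtain ⟨i, hi⟩ := 𝒰.nonempty_of_mem hS
      refine ⟨⟨i, x⟩, hi, fun C hC => ?_⟩
      obtain ⟨A, -, hx, rfl⟩ := hF hC
      exact hx)
  exact ⟨p, ultracopowerMap_eq p fun A hA hx => hp _ ⟨A, hA, hx, rfl⟩⟩

theorem preimage_snd_compl_closure_not_mem (p : Ultracopower G X 𝒰) {A : Set X} (hA : IsOpen A)
    (h : ultracopowerMap 𝒰 p ∈ A) : Sigma.snd ⁻¹' (closure A)ᶜ ∉ p.1 := by
  have : (fun q : G × X => q.1 • q.2) ⁻¹' A ∈ 𝓝 ((1 : G), ultracopowerMap 𝒰 p) :=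
    continuous_smul.continuousAt.preimage_mem_nhds (by simpa using hA.mem_nhds h)
  rw [nhds_prod_eq, mem_prod_iff] at this
  obtain ⟨U, hU, D', hD', hsub⟩ := this
  obtain ⟨D, hDD, hD, hpD⟩ := mem_nhds_iff.1 hD'
  refine fun hmem => p.1.compl_closure_smul_not_mem (preimage_snd_mem p hD hpD) hU
    (p.1.mem_of_superset hmem isClosed_closure.isOpen_compl ?_)
  refine compl_subset_compl.2 (closure_minimal ?_ (isClosed_closure.preimage continuous_snd))
  rintro _ ⟨g, hg, z, hz, rfl⟩
  exact subset_closure (hsub (show (g, z.2) ∈ U ×ˢ D' from ⟨hg, hDD hz⟩))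

theorem continuous_ultracopowerMap : Continuous (ultracopowerMap (G := G) (X := X) 𝒰) := by
  refine continuous_iff_continuousAt.2 fun p O hO => ?_
  obtain ⟨K, hK, hKc, hKO⟩ := exists_mem_nhds_isClosed_subset hO
  have hp := preimage_snd_compl_closure_not_mem p isOpen_interior (mem_interior_iff_mem_nhds.2 hK)
  have hopen : IsOpen (Sigma.snd ⁻¹' (closure (interior K))ᶜ : Set (Σ _ : I, X)) :=
    isClosed_closure.isOpen_compl.preimage continuous_snd
  rw [mem_map]
  filter_upwards [((GleasonCompletion.isOpen_setOf_not_mem hopen).preimage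
    continuous_val).mem_nhds hp] with q hq
  by_contra hqO
  refine hq (preimage_snd_mem q isClosed_closure.isOpen_compl fun hqK => hqO (hKO ?_))
  exact closure_minimal interior_subset hKc hqK

theorem inter_preimage_snd_mem (p : Ultracopower G X 𝒰) {C : Set (Σ _ : I, X)} (hC : C ∈ p.1)
    {A : Set X} (hA : IsOpen A) (h : ultracopowerMap 𝒰 p ∈ A) : C ∩ Sigma.snd ⁻¹' A ∈ p.1 := by
  obtain ⟨K, hK, hKc, hKA⟩ := exists_mem_nhds_isClosed_subset (hA.mem_nhds h)
  have hp := preimage_snd_compl_closure_not_mem p isOpen_interior (mem_interior_iff_mem_nhds.2 hK)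
  have h1 := (p.1.isOpen_of_mem hC).inter (hA.preimage (continuous_snd (I := I)))
  have h2 : IsOpen (Sigma.snd ⁻¹' (closure (interior K))ᶜ : Set (Σ _ : I, X)) :=
    isClosed_closure.isOpen_compl.preimage continuous_snd
  refine (p.1.mem_or_mem_of_union_mem h1 h2 (p.1.mem_of_superset hC (h1.union h2) fun z hz => ?_)
    ).resolve_right hp
  by_cases hzA : z.2 ∈ A
  · exact .inl ⟨hz, hzA⟩
  · exact .inr fun hzK => hzA (hKA (closure_minimal interior_subset hKc hzK))

/-- The part of an ultracopower above a `U`-TT set is `U`-small. -/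
theorem smul_mem_of_isUTT {U : Set G} {A : Set X} (hA : IsUTT U A) {p q : Ultracopower G X 𝒰}
    (hp : ultracopowerMap 𝒰 p ∈ A) (hq : ultracopowerMap 𝒰 q ∈ A) {C : Set (Σ _ : I, X)}
    (hC : C ∈ p.1) : U • C ∈ q.1 := by
  have hCo := p.1.isOpen_of_mem hC
  -- For `𝒰`-most `i` the slice of `C` meets `A`, so by transitivity its `U`-fattening is dense in
  -- `A`.
  have hS : {i : I | ∃ x ∈ A, (⟨i, x⟩ : Σ _ : I, X) ∈ C} ∈ 𝒰 := by
    by_contra hS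
    obtain ⟨z, ⟨hzC, hzA⟩, hzS⟩ := p.1.nonempty_of_mem
      (inter_preimage_fst_mem p (inter_preimage_snd_mem p hC hA.1 hp)
        (Ultrafilter.compl_mem_iff_notMem.2 hS))
    exact hzS ⟨z.2, hzA, hzC⟩
  refine q.1.mem_of_subset_closure (inter_preimage_fst_mem q (preimage_snd_mem q hA.1 hq) hS)
    hCo.smul_left ?_
  rintro ⟨i, x⟩ ⟨hx, y, hyA, hyC⟩
  have h := hA.2.2 (A ∩ (fun z : X => (⟨i, z⟩ : Σ _ : I, X)) ⁻¹' C) inter_subset_left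
    (hA.1.inter (hCo.preimage (continuous_sigmaMk (σ := fun _ : I => X)))) ⟨y, hyA, hyC⟩ hx
  refine closure_mono ?_ (image_closure_subset_closure_image
    (continuous_sigmaMk (σ := fun _ : I => X) (i := i)) ⟨x, h, rfl⟩)
  rintro _ ⟨_, ⟨g, hg, a, ha, rfl⟩, rfl⟩
  exact ⟨g, hg, ⟨i, a⟩, ha.2, rfl⟩

/-- The ultracopower map of a minimal flow which is somewhere `U`-TT for all `U` is highly
proximal. -/
theorem isHighlyProximal_ultracopowerMap [MulAction.IsMinimal G X]
    (h : ∀ U ∈ 𝓝 (1 : G), SomewhereUTT U (univ : Set X)) :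
    IsHighlyProximal G (ultracopowerMap (G := G) (X := X) 𝒰) := by
  refine ⟨continuous_ultracopowerMap, ultracopowerMap_smul, ultracopowerMap_surjective,
    fun x => ?_⟩
  obtain ⟨p, hp⟩ := ultracopowerMap_surjective (G := G) (𝒰 := 𝒰) x
  -- Elements moving `x` into a `U`-TT set; by minimality each is a non-empty set, and they generate
  -- the filter `l` as `U` shrinks.
  let T : Set G → Set G := fun U => {g | ∃ A : Set X, IsUTT U A ∧ g • x ∈ A}
  have hTmono : ∀ U V : Set G, U ⊆ V → T U ⊆ T V := fun U V hUV g ⟨A, hA, hg⟩ =>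
    ⟨A, hA.mono hUV, hg⟩
  have hTne : ∀ U ∈ 𝓝 (1 : G), (T U).Nonempty := fun U hU => by
    obtain ⟨A, -, hA⟩ := h U hU
    obtain ⟨g, hg⟩ := hA.1.exists_smul_mem G x hA.2.1
    exact ⟨g, A, hA, hg⟩
  let l : Filter G := (𝓝 (1 : G)).lift' T
  have hl : l.NeBot := (lift'_neBot_iff hTmono).2 hTne
  have hTl : ∀ U ∈ 𝓝 (1 : G), T U ∈ l := fun U hU => mem_lift' hU
  -- Only the orbit of one point `p` of the fibre is made to converge; TT smallness then drags the
  -- whole fibre along.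
  obtain ⟨y, hy⟩ := exists_clusterPt_of_compactSpace (map (fun g : G => g • p) l)
  have hl' : (comap (fun g : G => g • p) (𝓝 y) ⊓ l).NeBot := by
    rw [← map_neBot_iff (fun g : G => g • p), Filter.push_pull']
    exact hy
  refine ⟨_, hl', y, TopologicalSpace.tendsto_nhds_generateFrom_iff.2 ?_⟩
  rintro _ (⟨O, hO, rfl⟩ | ⟨O, hO, rfl⟩) hyO
  · obtain ⟨A, hA, hyA, hAO⟩ := exists_basic_nhds hO (singleton_subset_iff.1 hyO)
    obtain ⟨V, hV, -, hVA⟩ := y.1.exists_smul_not_mem hA hyA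
    have hN : {q : Ultracopower G X 𝒰 | V • A ∉ q.1} ∈ 𝓝 y :=
      ((GleasonCompletion.isOpen_setOf_not_mem hA.smul_left).preimage continuous_val).mem_nhds hVA
    filter_upwards [mem_inf_of_left (preimage_mem_comap hN), mem_inf_of_right (hTl V hV)]
      with g hg hgT
    obtain ⟨B, hB, hgB⟩ := hgT
    rintro _ ⟨q, hq, rfl⟩
    -- If a translated fibre point contained `A`, then `g • p` would contain `V • A`, against `hg`.
    refine hAO _ fun hAq => hg (smul_mem_of_isUTT hB ?_ ?_ hAq)
    · rw [ultracopowerMap_smul, show ultracopowerMap 𝒰 q = x from hq]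
      exact hgB
    · rw [ultracopowerMap_smul, hp]
      exact hgB
  · obtain ⟨_, rfl, hyO⟩ := hyO
    filter_upwards [mem_inf_of_left (preimage_mem_comap (IsOpen.mem_nhds hO hyO))] with g hg
    exact ⟨g • p, smul_mem_smul_set hp, hg⟩

end Ultracopower

end Ultracopower

/-! ### From unique minimal subflows to thickness. -/

section Thickness

variable {G : Type u} [Group G] [TopologicalSpace G] [IsTopologicalGroup G]
  {X : Type v} [TopologicalSpace X] [MulAction G X] [ContinuousConstSMul G X]

/-- The open subset of `Finset G × X` whose fibre at `F` is `F A_F`. -/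
def finsetTranslates (A : Finset G → Set X) : Set (Σ _ : ULift.{w} (Finset G), X) :=
  {z | z.2 ∈ (z.1.down : Set G) • A z.1.down}

omit [TopologicalSpace G] [IsTopologicalGroup G] in
theorem isOpen_finsetTranslates {A : Finset G → Set X} (hA : ∀ F, IsOpen (A F)) :
    IsOpen (finsetTranslates.{u, v, w} A) :=
  isOpen_sigma_iff.2 fun i => (hA i.down).smul_left (s := (i.down : Set G))

/-- Requiring all translates makes the set invariant. It is non-empty because, for finitely many
`g`, `𝒰`-most `F` contain them all, and then each `g` sends `A_F` into `F A_F`. -/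
theorem isSubflow_setOf_finsetTranslates_mem {A : Finset G → Set X} (hA : ∀ F, IsOpen (A F))
    (hAn : ∀ F, (A F).Nonempty) {𝒰 : Ultrafilter (ULift.{w} (Finset G))}
    (h𝒰 : ∀ g : G, {i : ULift.{w} (Finset G) | g ∈ i.down} ∈ 𝒰) :
    IsSubflow G {p : Ultracopower G X 𝒰 | ∀ g : G, finsetTranslates A ∈ (g • p).1} := by
  have ho := isOpen_finsetTranslates.{u, v, w} hA
  refine ⟨?_, ?_, fun k p hp g => ?_⟩
  · obtain ⟨p, hp⟩ := Ultracopower.exists_of_finite_inter (G := G) (𝒰 := 𝒰)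
      (P := range fun g : G => (g • ·) ⁻¹' finsetTranslates A)
      (by rintro _ ⟨g, rfl⟩; exact ho.preimage (continuous_const_smul g)) (fun F hF hFf S hS => by
        have h1 : (⋂ C ∈ F, {i : ULift.{w} (Finset G) | ∀ a ∈ A i.down,
            (⟨i, a⟩ : Σ _ : ULift.{w} (Finset G), X) ∈ C}) ∈ 𝒰 := by
          refine (biInter_mem hFf).2 fun C hC => ?_
          obtain ⟨g, rfl⟩ := hF hC
          exact Filter.mem_of_superset (h𝒰 g) fun i hi a ha => ⟨g, hi, a, ha, rfl⟩
        obtain ⟨i, hi, hiS⟩ := 𝒰.nonempty_of_mem (inter_mem h1 hS)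
        obtain ⟨a, ha⟩ := hAn i.down
        exact ⟨⟨i, a⟩, hiS, fun C hC => mem_iInter₂.1 hi C hC a ha⟩)
    exact ⟨p, fun g => hp _ ⟨g, rfl⟩⟩
  · refine IsClosed.isCompact ?_
    simp only [ofPred_forall]
    exact isClosed_iInter fun g => (GleasonCompletion.isClosed_setOf_mem
      (ho.preimage (continuous_const_smul g))).preimage Ultracopower.continuous_val
  · rw [smul_smul]
    exact hp (g * k)

theorem thicknessCondition_of_existsUnique_isMinimalSubflow
    (h : ∀ (I : Type (max u w)) (𝒰 : Ultrafilter I),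
      ∃! M : Set (Ultracopower G X 𝒰), IsMinimalSubflow G M) : ThicknessCondition G X := by
  intro U hU
  by_contra! hcon
  choose A B hA hAn hB hBn hAB using hcon
  -- An ultrafilter refining the direction of inclusion; `ULift` only adjusts the universe of the
  -- index set.
  let 𝒰 : Ultrafilter (ULift.{w} (Finset G)) :=
    (Ultrafilter.of (atTop : Filter (Finset G))).map ULift.up
  have h𝒰 : ∀ g : G, {i : ULift.{w} (Finset G) | g ∈ i.down} ∈ 𝒰 := fun g => by
    refine Ultrafilter.mem_map.2 (Ultrafilter.of_le (atTop : Filter (Finset G)) ?_)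
    filter_upwards [eventually_ge_atTop {g}] with F hF
    exact hF (Finset.mem_singleton_self g)
  obtain ⟨M, hMA, hM⟩ := (isSubflow_setOf_finsetTranslates_mem hA hAn h𝒰).exists_isMinimalSubflow
  obtain ⟨N, hNB, hN⟩ := (isSubflow_setOf_finsetTranslates_mem hB hBn h𝒰).exists_isMinimalSubflow
  obtain rfl := (h _ 𝒰).unique hM hN
  obtain ⟨p, hp⟩ := hM.1.1
  have h1 : finsetTranslates A ∈ p.1 := by simpa using hMA hp 1
  have h2 : finsetTranslates B ∈ p.1 := by simpa using hNB hp 1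
  obtain ⟨z, ⟨g, hg, a, ha, rfl⟩, ⟨k, hk, b, hb, hbz⟩⟩ := p.1.nonempty_inter h1 h2 hU
  -- The action preserves the index, so both points lie over one `F`, where the `U`-fattenings were
  -- chosen disjoint.
  have e1 : (k • b).1 = (g • a).1 := congrArg Sigma.fst hbz
  have e2 : k • b.2 = g • a.2 := by rw [Sigma.ext_iff] at hbz; exact eq_of_heq hbz.2
  have hb' : b.2 ∈ ((k • b).1.down : Set G) • B (k • b).1.down := hb
  rw [e1] at hb'
  exact (eq_empty_iff_forall_notMem.1 (hAB a.1.down)) (g • a.2)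
    ⟨⟨g, hg, a.2, ha, rfl⟩, ⟨k, hk, b.2, hb', e2⟩⟩

end Thickness

end GFlow

universe u v w

theorem theorem4p16 (G : Type u) [Group G] [TopologicalSpace G] [IsTopologicalGroup G]
    (X : Type v) [TopologicalSpace X] [CompactSpace X] [T2Space X] [Nonempty X]
    [MulAction G X] [ContinuousSMul G X] (hX : IsGED G X) :
    (MulAction.IsMinimal G X →
      List.TFAE [
        RosendalCriterion G X,
        ∀ U ∈ nhds (1 : G), SomewhereUTT U (Set.univ : Set X),
        ThicknessCondition G X,
        ∀ (I : Type (max u w)) (𝒰 : Ultrafilter I),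
          ∃! M : Set (Ultracopower G X 𝒰), IsMinimalSubflow G M,
        ∀ (I : Type (max u w)) (𝒰 : Ultrafilter I),
          IsHighlyProximal G (ultracopowerMap (G := G) (X := X) 𝒰),
        ∀ σ ∈ SN G, Dense {x : X | IsCompatiblePoint (pdist σ) x},
        ∀ (σ : GroupSeminorm G) (hσ : σ ∈ SN G),
          Dense {x : PdistQuotient hX hσ | IsCompatiblePoint (quotientPdist hX hσ) x},
        ∃ B : Set (GroupSeminorm G), IsSNBase B ∧
          ∀ σ ∈ B, ∃ x : X, IsCompatiblePoint (pdist σ) x]) ∧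
    (MulAction.IsTopologicallyTransitive G X →
      List.TFAE [
        RosendalCriterion G X,
        ∀ σ ∈ SN G, Dense {x : X | IsCompatiblePoint (pdist σ) x},
        ∀ (σ : GroupSeminorm G) (hσ : σ ∈ SN G),
          Dense {x : PdistQuotient hX hσ | IsCompatiblePoint (quotientPdist hX hσ) x}]) := by
  have h67 := fun (h : ∀ σ ∈ SN G, Dense {x : X | IsCompatiblePoint (pdist σ) x}) σ hσ =>
    dense_isCompatiblePoint_quotient hX hσ (h σ hσ)
  have h71 := rosendalCriterion_of_dense_quotient hX
  have h16 := fun (h : RosendalCriterion G X) σ (hσ : σ ∈ SN G) =>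
    dense_isCompatiblePoint_of_rosendalCriterion h hσ
  refine ⟨fun hmin => ?_, fun _ => ?_⟩
  · tfae_have 1 → 2 := fun h U hU => h U hU univ isOpen_univ univ_nonempty
    tfae_have 2 → 1 := rosendalCriterion_of_somewhereUTT
    tfae_have 2 → 3 := thicknessCondition_of_somewhereUTT
    tfae_have 3 → 2 := somewhereUTT_of_thicknessCondition
    tfae_have 2 → 5 := fun h I 𝒰 => Ultracopower.isHighlyProximal_ultracopowerMap h
    tfae_have 5 → 4 := fun h I 𝒰 => (h I 𝒰).existsUnique_isMinimalSubflow
    tfae_have 4 → 3 := thicknessCondition_of_existsUnique_isMinimalSubflow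
    tfae_have 1 → 6 := h16
    tfae_have 6 → 7 := h67
    tfae_have 7 → 1 := h71
    tfae_have 6 → 8 := fun h => ⟨SN G, isSNBase_SN, fun σ hσ => (h σ hσ).nonempty⟩
    tfae_have 8 → 2 := fun ⟨B, hB, h⟩ => somewhereUTT_of_isSNBase hX hB h
    tfae_finish
  · tfae_have 1 → 2 := h16
    tfae_have 2 → 3 := h67
    tfae_have 3 → 1 := h71
    tfae_finish
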